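/- **Conventions.** For a finite alphabet $A$ and a surjective homomorphism $\pi:A^*\to G$ onto a group, $d_A$ is the word metric on $G$ (path length in the Cayley graph with respect to $A\pi$, edges traversed in both directions), and $u^{[n]}$ is the prefix of length $n$ of a word $u$ (with $u^{[n]}=u$ for $n>|u|$). Homomorphisms are written on the right. A regular language $L\subseteq A^*$ with $L\pi=G$ is a *rational section* of $\pi$. It is an *automatic structure* for $\pi$ if moreover for every $x\in A\cup\{1\}$ the language of convolutions $\{u\diamond v\mid u,v\in L,\ v\pi=(ux)\pi\}$ is regular (the convolution pads the shorter word with a symbol $\$$). It is an *asynchronous automatic structure* if it is a rational section and there is $p$ such that for all $u,v\in L$ with $d_A(u\pi,v\pi)\le 1$ there are nondecreasing surjections $s,t:\mathbb N\to\mathbb N$ with $d_A(u^{[s(n)]}\pi,v^{[t(n)]}\pi)\le p$ for all $n$. Automatic structures $L\subseteq A^*$, $M\subseteq C^*$ for the same group are *equivalent* (resp. *synchronously equivalent*) if $L\cup M$, over the disjoint union of $A$ and $C$ with the natural homomorphism $(A\sqcup C)^*\to G$, is an asynchronous automatic structure (resp. an automatic structure). Let $G_1,G_2$ be groups with automatic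 structures $L_1$ for $\pi_1:A^*\to G_1$ and $L_2$ for $\pi_2:B^*\to G_2$, and let $\varphi:G_1\to G_2$ be a homomorphism. * *The BRP holds for $(\varphi,L_1,L_2)$* if there is $N>0$ such that for all $x\in G_1$, $\alpha\in L_1$, $\beta\in L_2$ with $\beta\pi_2=\alpha\pi_1\varphi$, the finite sets $\{(x(\alpha^{[n]}\pi_1))\varphi\mid 0\le n\le|\alpha|\}$ and $\{x\varphi(\beta^{[n]}\pi_2)\mid 0\le n\le|\beta|\}$ are at Hausdorff distance at most $N$ with respect to $d_B$. *The synchronous BRP holds* if there is $N>0$ such that $d_B\big((x(\alpha^{[n]}\pi_1))\varphi,\ x\varphi(\beta^{[n]}\pi_2)\big)\le N$ for all such $x,\alpha,\beta$ and all $n\in\mathbb N$. * A subgroup $H\le G_2$ is *$L_2$-quasiconvex with constant $k\in\mathbb N$* if for all $h,h'\in H$ and $w\in L_2$ with $h(w\pi_2)=h'$ one has $d_B(h(w^{[n]}\pi_2),H)\le k$ for all $n$. For such $H$ and $k$, the language $L_2''(H)$ consists of all words $c_1\cdots c_n$ obtained as follows: take $w=b_1\cdots b_n\in L_2$ with $w\pi_2\in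 H$ and words $g_0,\dots,g_n$ over $B\cup B^{-1}$ of length at most $k$, with $g_0,g_n$ empty and $w^{[i]}g_i$ representing an element of $H$ for every $i$; the letter $c_i$ is the word $g_{i-1}^{-1}b_ig_i$. Its alphabet $C$ is the (finite) set of all words that arise as such letters, together with their inverses, each read as the element of $H$ it represents. * *$L_1$ induces an automatic structure through $\varphi$* if $L_1$ is an automatic structure for $\pi_1\varphi:A^*\to G_1\varphi$; this structure is denoted $L_1^{(\varphi)}$. **Theorem.** Suppose that $G_1\varphi$ is $L_2$-quasiconvex with constant $k$ and that $L_1$ induces an automatic structure through $\varphi$. Let $L_2''(G_1\varphi)$ be formed with the constant $k$. Then 1. $L_1^{(\varphi)}$ and $L_2''(G_1\varphi)$ are equivalent if and only if the BRP holds for $(\varphi,L_1,L_2)$; 2. $L_1^{(\varphi)}$ and $L_2''(G_1\varphi)$ are synchronously equivalent if and only if the synchronous BRP holds for $(\varphi,L_1,L_2)$. -/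

import Mathlib

open scoped ENNReal

namespace AutGroups

universe u v w

section Words

variable {G : Type u} [Group G] {A : Type v}

/-- The element of `G` represented by a word over `A`, for a homomorphism `π : A* → G`. -/
def wordVal (π : FreeMonoid A →* G) (w : List A) : G := π (FreeMonoid.ofList w)

/-- The image in `G` of the alphabet `A`. -/
def genSet (π : FreeMonoid A →* G) : Set G := Set.range fun a => π (FreeMonoid.of a)

/-- The geodesic metric `d_A` on `G`: the length of a shortest path in the (undirected) Cayley graph
of `G` with respect to the image of `A` (`⊤` if there is no path, which does not happen when the
image of `A` generates `G`). -/
noncomputable def wordDist (π : FreeMonoid A →* G) (x y : G) : ℕ∞ :=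
  (SimpleGraph.mulCayley (genSet π)).edist x y

/-- The distance from a point to a set, for a distance function `d`. -/
noncomputable def setDist (d : G → G → ℕ∞) (x : G) (Y : Set G) : ℝ≥0∞ :=
  ⨅ y ∈ Y, ((d x y : ℕ∞) : ℝ≥0∞)

/-- The closed `ε`-neighbourhood of a set. -/
def nhd (d : G → G → ℕ∞) (ε : ℝ≥0∞) (Y : Set G) : Set G := {x | setDist d x Y ≤ ε}

/-- The Hausdorff distance between two sets. -/
noncomputable def haus (d : G → G → ℕ∞) (Y Z : Set G) : ℝ≥0∞ :=
  sInf {ε | 0 < ε ∧ Y ⊆ nhd d ε Z ∧ Z ⊆ nhd d ε Y}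

end Words

section AutomaticStructures

variable {G : Type u} [Group G] {A : Type v} {B : Type w}

/-- The alphabet `A_$ = (A × A) ∪ (A × {$}) ∪ ({$} × A)`. -/
inductive Pad (A : Type v) : Type v
  | both (a b : A) : Pad A
  | left (a : A) : Pad A
  | right (b : A) : Pad A

/-- The convolution `u ⋄ v` of two words: the shorter one is padded with `$`. -/
def conv : List A → List A → List (Pad A)
  | [], v => v.map Pad.right
  | a :: u, [] => Pad.left a :: conv u []
  | a :: u, b :: v => Pad.both a b :: conv u v

/-- `L` is a rational section of `π`. -/
structure IsRationalSection (π : FreeMonoid A →* G) (L : Language A) : Prop where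
  surjective : Function.Surjective π
  regular : L.IsRegular
  onto : ∀ g : G, ∃ w ∈ L, wordVal π w = g

/-- `L` is a (synchronous) automatic structure for `π`: a rational section such that, for every
`x ∈ A ∪ {1}`, a finite automaton over `A_$` accepts
`{u ⋄ v | u, v ∈ L, v π = (u x) π}`; here `x` is a word of length at most one. -/
structure IsAutomatic (π : FreeMonoid A →* G) (L : Language A) : Prop
    extends IsRationalSection π L where
  multiplier : ∀ x : Option A, Language.IsRegular
    ({c | ∃ u ∈ L, ∃ v ∈ L, wordVal π v = wordVal π (u ++ x.toList) ∧ c = conv u v} :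
      Language (Pad A))

/-- The words `u` and `v` asynchronously `p`-fellow travel. -/
def AsyncFellowTravel (π : FreeMonoid A →* G) (p : ℕ) (u v : List A) : Prop :=
  ∃ s t : ℕ → ℕ, Monotone s ∧ Function.Surjective s ∧ Monotone t ∧ Function.Surjective t ∧
    ∀ n : ℕ, wordDist π (wordVal π (u.take (s n))) (wordVal π (v.take (t n))) ≤ p

/-- `L` is an asynchronous automatic structure for `π`: a rational section with the asynchronous
fellow traveller property. -/
structure IsAsyncAutomatic (π : FreeMonoid A →* G) (L : Language A) : Prop
    extends IsRationalSection π L where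
  fellowTravel : ∃ p : ℕ, ∀ u ∈ L, ∀ v ∈ L,
    wordDist π (wordVal π u) (wordVal π v) ≤ 1 → AsyncFellowTravel π p u v

/-- The homomorphism `(A ∪ B)* → G` extending two homomorphisms `A* → G` and `B* → G`. -/
def unionHom (π₁ : FreeMonoid A →* G) (π₂ : FreeMonoid B →* G) : FreeMonoid (A ⊕ B) →* G :=
  FreeMonoid.lift (Sum.elim (fun a => π₁ (FreeMonoid.of a)) (fun b => π₂ (FreeMonoid.of b)))

/-- The union `L₁ ∪ L₂` as a language over the disjoint union of the two alphabets. -/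
def unionLang (L₁ : Language A) (L₂ : Language B) : Language (A ⊕ B) :=
  {w | (∃ u ∈ L₁, w = u.map Sum.inl) ∨ (∃ v ∈ L₂, w = v.map Sum.inr)}

/-- Equivalence of two structures: their union is an asynchronous automatic structure. -/
def Equivalent (π₁ : FreeMonoid A →* G) (L₁ : Language A)
    (π₂ : FreeMonoid B →* G) (L₂ : Language B) : Prop :=
  IsAsyncAutomatic (unionHom π₁ π₂) (unionLang L₁ L₂)

/-- Synchronous equivalence of two structures: their union is an automatic structure. -/
def SyncEquivalent (π₁ : FreeMonoid A →* G) (L₁ : Language A)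
    (π₂ : FreeMonoid B →* G) (L₂ : Language B) : Prop :=
  IsAutomatic (unionHom π₁ π₂) (unionLang L₁ L₂)

end AutomaticStructures

section BRP

variable {G₁ : Type*} [Group G₁] {G₂ : Type*} [Group G₂] {A B : Type*}

/-- The vertex reached after `n` letters (or at the end of the word, if `n` exceeds its length) on
the path labelled `w` starting at `x`. -/
def path (π : FreeMonoid A →* G₁) (x : G₁) (w : List A) (n : ℕ) : G₁ :=
  x * wordVal π (w.take n)

/-- The set of vertices on the path labelled `w` starting at `x`. -/
def pathImage (π : FreeMonoid A →* G₁) (x : G₁) (w : List A) : Set G₁ :=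
  {g | ∃ n ≤ w.length, g = path π x w n}

/-- The bounded reduction property for `(φ, L₁, L₂)`. -/
def BRP (φ : G₁ →* G₂) (π₁ : FreeMonoid A →* G₁) (L₁ : Language A)
    (π₂ : FreeMonoid B →* G₂) (L₂ : Language B) : Prop :=
  ∃ N : ℕ, 0 < N ∧ ∀ x : G₁, ∀ α ∈ L₁, ∀ β ∈ L₂, wordVal π₂ β = φ (wordVal π₁ α) →
    haus (wordDist π₂) (φ '' pathImage π₁ x α) (pathImage π₂ (φ x) β) ≤ N

/-- The synchronous bounded reduction property for `(φ, L₁, L₂)`. -/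
def SyncBRP (φ : G₁ →* G₂) (π₁ : FreeMonoid A →* G₁) (L₁ : Language A)
    (π₂ : FreeMonoid B →* G₂) (L₂ : Language B) : Prop :=
  ∃ N : ℕ, 0 < N ∧ ∀ n : ℕ, ∀ x : G₁, ∀ α ∈ L₁, ∀ β ∈ L₂,
    wordVal π₂ β = φ (wordVal π₁ α) →
    wordDist π₂ (φ (path π₁ x α n)) (path π₂ (φ x) β n) ≤ N

/-- `L₁` induces an automatic structure through `φ`: it is an automatic structure for
`π₁ φ : A* → φ(G₁)`. -/
def InducesAutomatic (φ : G₁ →* G₂) (π₁ : FreeMonoid A →* G₁) (L₁ : Language A) : Prop :=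
  IsAutomatic (φ.rangeRestrict.comp π₁) L₁

end BRP

section Quasiconvex

variable {G : Type u} [Group G] {B : Type v}

/-- `H` is `L`-quasiconvex with constant `k`. -/
def IsQuasiconvexWith (π : FreeMonoid B →* G) (L : Language B) (H : Subgroup G) (k : ℕ) : Prop :=
  ∀ h ∈ H, ∀ h' ∈ H, ∀ w ∈ L, h * wordVal π w = h' →
    ∀ n : ℕ, setDist (wordDist π) (h * wordVal π (w.take n)) (H : Set G) ≤ k

/-- The element of `G` represented by a word over `B ∪ B⁻¹`. -/
def signedVal (π : FreeMonoid B →* G) (w : List (B × Bool)) : G :=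
  FreeGroup.lift (fun b => π (FreeMonoid.of b)) (FreeGroup.mk w)

/-- `L'(H)`: the words of `L` that represent elements of `H`. -/
def langIn (π : FreeMonoid B →* G) (L : Language B) (H : Subgroup G) : Language B :=
  {w | w ∈ L ∧ wordVal π w ∈ H}

/-- An admissible choice of correcting words `g 0, …, g n` for a word `w` of length `n`: they have
length at most `k`, the first and the last are empty, and the prefix of `w` of length `i` followed
by `g i` represents an element of `H`. -/
structure IsCorrection (π : FreeMonoid B →* G) (H : Subgroup G) (k : ℕ) (w : List B)
    (g : ℕ → List (B × Bool)) : Prop where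
  first : g 0 = []
  last : g w.length = []
  short : ∀ i ≤ w.length, (g i).length ≤ k
  mem : ∀ i ≤ w.length, wordVal π (w.take i) * signedVal π (g i) ∈ H

/-- The rewriting of `w = b₁ ⋯ bₙ` given by the correcting words `g`: its `i`-th letter is the word
`(g (i-1))⁻¹ bᵢ (g i)`. -/
def rewriteWord (w : List B) (g : ℕ → List (B × Bool)) : List (List (B × Bool)) :=
  w.mapIdx fun i b => FreeGroup.invRev (g i) ++ (b, true) :: g (i + 1)

/-- The standard alphabet of `L''(H)`: the words that occur as letters when the words of `L'(H)`
are rewritten, together with their inverses. -/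
def stdGens (π : FreeMonoid B →* G) (L : Language B) (H : Subgroup G) (k : ℕ) :
    Set (List (B × Bool)) :=
  {c | ∃ w ∈ langIn π L H, ∃ g, IsCorrection π H k w g ∧
    (c ∈ rewriteWord w g ∨ FreeGroup.invRev c ∈ rewriteWord w g)}

theorem signedVal_append (π : FreeMonoid B →* G) (x y : List (B × Bool)) :
    signedVal π (x ++ y) = signedVal π x * signedVal π y := by
  simp only [signedVal, ← FreeGroup.mul_mk, map_mul]

theorem signedVal_invRev (π : FreeMonoid B →* G) (x : List (B × Bool)) :
    signedVal π (FreeGroup.invRev x) = (signedVal π x)⁻¹ := by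
  simp only [signedVal, ← FreeGroup.inv_mk, map_inv]

theorem signedVal_mem_of_mem_rewriteWord {π : FreeMonoid B →* G} {H : Subgroup G} {k : ℕ}
    {w : List B} {g : ℕ → List (B × Bool)} (hg : IsCorrection π H k w g)
    {c : List (B × Bool)} (hc : c ∈ rewriteWord w g) : signedVal π c ∈ H := by
  rw [rewriteWord, List.mem_mapIdx] at hc
  obtain ⟨i, hi, rfl⟩ := hc
  have h1 := hg.mem i hi.le
  have h2 := hg.mem (i + 1) hi
  have h3 : wordVal π (w.take (i + 1)) = wordVal π (w.take i) * π (FreeMonoid.of w[i]) := by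
    rw [List.take_succ_eq_append_getElem hi, wordVal, FreeMonoid.ofList_append, map_mul]
    rfl
  have h4 : signedVal π ((w[i], true) :: g (i + 1)) =
      π (FreeMonoid.of w[i]) * signedVal π (g (i + 1)) := by
    rw [show (w[i], true) :: g (i + 1) = [(w[i], true)] ++ g (i + 1) from rfl, signedVal_append]
    simp [signedVal]
  rw [signedVal_append, signedVal_invRev, h4]
  have h5 := H.mul_mem (H.inv_mem h1) h2
  rw [h3] at h5
  convert h5 using 1
  group

theorem signedVal_mem_of_mem_stdGens {π : FreeMonoid B →* G} {L : Language B} {H : Subgroup G}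
    {k : ℕ} {c : List (B × Bool)} (hc : c ∈ stdGens π L H k) : signedVal π c ∈ H := by
  obtain ⟨w, -, g, hg, h | h⟩ := hc
  · exact signedVal_mem_of_mem_rewriteWord hg h
  · have := signedVal_mem_of_mem_rewriteWord hg h
    rw [signedVal_invRev] at this
    exact inv_mem_iff.mp this

/-- The standard alphabet is finite. -/
theorem finite_stdGens [Finite B] (π : FreeMonoid B →* G) (L : Language B) (H : Subgroup G)
    (k : ℕ) : (stdGens π L H k).Finite := by
  have key : ∀ w : List B, ∀ g, IsCorrection π H k w g → ∀ c ∈ rewriteWord w g,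
      c.length ≤ 2 * k + 1 := by
    intro w g hg c hc
    rw [rewriteWord, List.mem_mapIdx] at hc
    obtain ⟨i, hi, rfl⟩ := hc
    have h1 := hg.short i hi.le
    have h2 := hg.short (i + 1) hi
    simp only [List.length_append, FreeGroup.invRev_length, List.length_cons]
    omega
  refine (List.finite_length_le (B × Bool) (2 * k + 1)).subset ?_
  rintro c ⟨w, -, g, hg, h | h⟩
  · exact key w g hg c h
  · have := key w g hg _ h
    rwa [FreeGroup.invRev_length] at this

/-- The homomorphism `C* → H` from the words over the standard alphabet `C` of `L''(H)`. -/
def stdHom (π : FreeMonoid B →* G) (L : Language B) (H : Subgroup G) (k : ℕ) :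
    FreeMonoid (stdGens π L H k) →* H :=
  FreeMonoid.lift fun c => ⟨signedVal π c.1, signedVal_mem_of_mem_stdGens c.2⟩

/-- `L''(H)`: all rewritings of the words of `L'(H)`, as words over the standard alphabet. -/
def stdLang (π : FreeMonoid B →* G) (L : Language B) (H : Subgroup G) (k : ℕ) :
    Language (stdGens π L H k) :=
  {c | ∃ w ∈ langIn π L H, ∃ g, IsCorrection π H k w g ∧
    c.map Subtype.val = rewriteWord w g}

end Quasiconvex

end AutGroups

namespace AutGroups

/-! ### Word metrics: signed words, left invariance, Lipschitz and proper maps. -/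

section Metric

variable {G H : Type*} [Group G] [Group H] {A B : Type*}

/-! Let `H` be the image of `φ`. Its inclusion into `G₂` is Lipschitz (`exists_wordDist_map_le`) and
proper (`exists_wordDist_le_of_map_le`), so bounding distances in `H`, over any finite generating
alphabet, amounts to bounding them in `d_B`. A word of `L₂''(H)` is a shadow (`IsShadow`) of a word
of `L₂`: same length, same value, prefixes within `k`. By quasiconvexity every word of `L₂` with
value in `H` has a shadow. Hence comparing `L₁` with `L₂''(H)` inside `H` is the same as comparing
images of `L₁`-paths with `L₂`-paths in `G₂`.

If the structures are equivalent, `α` and the shadow of `β` have the same value, so they fellow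
travel; passing from the shadow to `β` and translating by `φ x` gives the BRP.

For the converse the BRP is only needed at `x = 1`. In the synchronous case it yields the fellow
traveller property of the union, and a rational section with that property is automatic because each
multiplier language has finitely many left quotients (`IsRationalSection.isAutomatic`). In the
asynchronous case it only places each prefix of `α` near some prefix of `β`, in no particular order.
Order is restored because paths of an automatic structure do not return
(`IsAutomatic.exists_no_return`): replacing the matched indices by their running maximum costs a
bounded amount (`exists_monotone_near`, `IsAutomatic.exists_async`). Both cases also need `L₂''(H)`
to be regular (`isRegular_stdLang`). -/

theorem signedVal_nil (π : FreeMonoid A →* G) : signedVal π [] = 1 := by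
  simp [signedVal]

theorem signedVal_cons (π : FreeMonoid A →* G) (a : A × Bool) (l : List (A × Bool)) :
    signedVal π (a :: l) = signedVal π [a] * signedVal π l :=
  signedVal_append π [a] l

theorem signedVal_singleton_true (π : FreeMonoid A →* G) (a : A) :
    signedVal π [(a, true)] = π (FreeMonoid.of a) := by
  simp [signedVal]

theorem signedVal_singleton_false (π : FreeMonoid A →* G) (a : A) :
    signedVal π [(a, false)] = (π (FreeMonoid.of a))⁻¹ := by
  simp [signedVal]

theorem wordVal_nil (π : FreeMonoid A →* G) : wordVal π [] = 1 := map_one π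

theorem wordVal_append (π : FreeMonoid A →* G) (u v : List A) :
    wordVal π (u ++ v) = wordVal π u * wordVal π v := by
  rw [wordVal, FreeMonoid.ofList_append, map_mul]; rfl

theorem wordVal_cons (π : FreeMonoid A →* G) (a : A) (v : List A) :
    wordVal π (a :: v) = π (FreeMonoid.of a) * wordVal π v :=
  wordVal_append π [a] v

theorem signedVal_map_true (π : FreeMonoid A →* G) (w : List A) :
    signedVal π (w.map (·, true)) = wordVal π w := by
  induction w with
  | nil => rw [wordVal_nil, List.map_nil, signedVal_nil]
  | cons a w ih => rw [List.map_cons, signedVal_cons, ih, signedVal_singleton_true, wordVal_cons]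

theorem wordDist_self (π : FreeMonoid A →* G) (x : G) : wordDist π x x = 0 :=
  SimpleGraph.edist_self

theorem wordDist_comm (π : FreeMonoid A →* G) (x y : G) : wordDist π x y = wordDist π y x :=
  SimpleGraph.edist_comm

theorem wordDist_triangle {π : FreeMonoid A →* G} {x y z : G} {m n : ℕ}
    (h₁ : wordDist π x y ≤ m) (h₂ : wordDist π y z ≤ n) : wordDist π x z ≤ (m + n : ℕ) := by
  push_cast
  exact (SimpleGraph.edist_triangle (v := y)).trans (add_le_add h₁ h₂)

theorem wordDist_mono {π : FreeMonoid A →* G} {x y : G} {m n : ℕ}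
    (h : wordDist π x y ≤ m) (hmn : m ≤ n) : wordDist π x y ≤ n :=
  h.trans (by exact_mod_cast hmn)

theorem wordDist_mul_signedVal_singleton (π : FreeMonoid A →* G) (x : G) (a : A × Bool) :
    wordDist π x (x * signedVal π [a]) ≤ 1 := by
  rw [wordDist, SimpleGraph.edist_le_one_iff_adj_or_eq, SimpleGraph.mulCayley_adj']
  by_cases h : x = x * signedVal π [a]
  · exact Or.inr h
  refine Or.inl ⟨h, π (FreeMonoid.of a.1), ⟨a.1, rfl⟩, ?_⟩
  obtain ⟨a, _ | _⟩ := a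
  · right; rw [signedVal_singleton_false]; group
  · left; rw [signedVal_singleton_true]

theorem wordDist_mul_signedVal (π : FreeMonoid A →* G) (x : G) (l : List (A × Bool)) :
    wordDist π x (x * signedVal π l) ≤ l.length := by
  induction l generalizing x with
  | nil => rw [signedVal_nil, mul_one, wordDist_self]; exact zero_le
  | cons a l ih =>
    rw [signedVal_cons, ← mul_assoc, List.length_cons, add_comm]
    exact wordDist_triangle (wordDist_mul_signedVal_singleton π x a) (ih _)

theorem exists_signedVal_of_walk {π : FreeMonoid A →* G} {x y : G}
    (p : (SimpleGraph.mulCayley (genSet π)).Walk x y) :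
    ∃ l : List (A × Bool), l.length = p.length ∧ x * signedVal π l = y := by
  induction p with
  | nil => exact ⟨[], rfl, by rw [signedVal_nil, mul_one]⟩
  | cons h p ih =>
    obtain ⟨l, hl, hy⟩ := ih
    rw [SimpleGraph.mulCayley_adj'] at h
    obtain ⟨-, _, ⟨a, rfl⟩, h | h⟩ := h
    · refine ⟨(a, true) :: l, by simp [hl], ?_⟩
      rw [signedVal_cons, signedVal_singleton_true, ← mul_assoc, h, hy]
    · refine ⟨(a, false) :: l, by simp [hl], ?_⟩
      rw [signedVal_cons, signedVal_singleton_false, h, ← mul_assoc, mul_inv_cancel_right, hy]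

/-- Walks in the Cayley graph spell signed words. This form makes left invariance and the finiteness
of balls immediate. -/
theorem wordDist_le_iff {π : FreeMonoid A →* G} {x y : G} {n : ℕ} :
    wordDist π x y ≤ n ↔ ∃ l : List (A × Bool), l.length ≤ n ∧ x * signedVal π l = y := by
  constructor
  · intro h
    obtain ⟨p, hp⟩ := SimpleGraph.exists_walk_of_edist_ne_top
      (ne_top_of_le_ne_top (ENat.natCast_ne_top n) h)
    obtain ⟨l, hl, hy⟩ := exists_signedVal_of_walk p
    refine ⟨l, ?_, hy⟩
    rw [wordDist, ← hp] at h
    rw [hl]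
    exact_mod_cast h
  · rintro ⟨l, hl, rfl⟩
    exact wordDist_mono (wordDist_mul_signedVal π x l) hl

theorem wordDist_mul_left_le {π : FreeMonoid A →* G} {x y : G} {n : ℕ} (g : G)
    (h : wordDist π x y ≤ n) : wordDist π (g * x) (g * y) ≤ n := by
  rw [wordDist_le_iff] at h ⊢
  obtain ⟨l, hl, rfl⟩ := h
  exact ⟨l, hl, mul_assoc _ _ _⟩

theorem wordDist_inv_mul_le {π : FreeMonoid A →* G} {x y : G} {n : ℕ}
    (h : wordDist π x y ≤ n) : wordDist π 1 (x⁻¹ * y) ≤ n := by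
  simpa using wordDist_mul_left_le x⁻¹ h

theorem wordDist_mul_wordVal (π : FreeMonoid A →* G) (x : G) (w : List A) :
    wordDist π x (x * wordVal π w) ≤ w.length := by
  have := wordDist_mul_signedVal π x (w.map (·, true))
  rwa [signedVal_map_true, List.length_map] at this

theorem wordDist_take_succ (π : FreeMonoid A →* G) (w : List A) (i : ℕ) :
    wordDist π (wordVal π (w.take i)) (wordVal π (w.take (i + 1))) ≤ (1 : ℕ) := by
  rw [List.take_add_one, wordVal_append]
  refine wordDist_mono (wordDist_mul_wordVal _ _ _) ?_
  cases w[i]? <;> simp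

theorem exists_wordVal_eq {π : FreeMonoid A →* G} (hπ : Function.Surjective π) (g : G) :
    ∃ w : List A, wordVal π w = g := by
  obtain ⟨w, hw⟩ := hπ g
  exact ⟨w.toList, hw⟩

theorem exists_wordDist_le {π : FreeMonoid A →* G} (hπ : Function.Surjective π) (x y : G) :
    ∃ n : ℕ, wordDist π x y ≤ n := by
  obtain ⟨w, hw⟩ := exists_wordVal_eq hπ (x⁻¹ * y)
  refine ⟨w.length, ?_⟩
  have := wordDist_mul_wordVal π x w
  rwa [hw, mul_inv_cancel_left] at this

theorem finite_ball [Finite A] (π : FreeMonoid A →* G) (n : ℕ) :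
    {g : G | wordDist π 1 g ≤ n}.Finite := by
  refine ((List.finite_length_le (A × Bool) n).image (signedVal π)).subset ?_
  intro g hg
  obtain ⟨l, hl, h⟩ := wordDist_le_iff.mp hg
  exact ⟨l, hl, by simpa using h⟩

/-- A homomorphism between finitely generated groups is Lipschitz. -/
theorem exists_wordDist_map_le [Finite A] (ψ : G →* H) (π : FreeMonoid A →* G)
    {ρ : FreeMonoid B →* H} (hρ : Function.Surjective ρ) :
    ∃ M : ℕ, ∀ (n : ℕ) (x y : G), wordDist π x y ≤ n →
      wordDist ρ (ψ x) (ψ y) ≤ (M * n : ℕ) := by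
  choose f hf using fun a : A × Bool => exists_wordDist_le hρ 1 (ψ (signedVal π [a]))
  obtain ⟨M, hM⟩ := (Set.finite_range f).bddAbove
  refine ⟨M, fun n x y h => ?_⟩
  obtain ⟨l, hl, rfl⟩ := wordDist_le_iff.mp h
  refine wordDist_mono (m := M * l.length) ?_ (Nat.mul_le_mul_left M hl)
  clear h hl
  induction l generalizing x with
  | nil => rw [signedVal_nil, mul_one, wordDist_self]; exact zero_le
  | cons a l ih =>
    rw [signedVal_cons, ← mul_assoc, List.length_cons, Nat.mul_succ, add_comm]
    refine wordDist_triangle ?_ (ih _)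
    rw [map_mul]
    have := wordDist_mul_left_le (ψ x) (wordDist_mono (hf a) (hM ⟨a, rfl⟩))
    rwa [mul_one] at this

/-- An injective homomorphism into a finitely generated group is a proper map. -/
theorem exists_wordDist_le_of_map_le [Finite B] {ψ : G →* H} (hψ : Function.Injective ψ)
    {π : FreeMonoid A →* G} (hπ : Function.Surjective π) (ρ : FreeMonoid B →* H) (r : ℕ) :
    ∃ M : ℕ, ∀ x y : G, wordDist ρ (ψ x) (ψ y) ≤ r → wordDist π x y ≤ M := by
  choose f hf using fun g : G => exists_wordDist_le hπ 1 g
  -- By injectivity only finitely many elements map into the `r`-ball; `M` bounds their distances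
  -- from `1`, and left invariance does the rest.
  obtain ⟨M, hM⟩ :=
    (((finite_ball ρ r).preimage (hψ.injOn (s := ψ ⁻¹' {g : H | wordDist ρ 1 g ≤ r}))).image
      f).bddAbove
  refine ⟨M, fun x y h => ?_⟩
  have h₁ : wordDist ρ 1 (ψ (x⁻¹ * y)) ≤ r := by
    rw [map_mul, map_inv]; exact wordDist_inv_mul_le h
  have := wordDist_mul_left_le x (wordDist_mono (hf (x⁻¹ * y)) (hM ⟨_, h₁, rfl⟩))
  rwa [mul_one, mul_inv_cancel_left] at this

end Metric

/-! ### Extracting nearby points from distances to sets. -/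

section Hausdorff

variable {G : Type*}

/-- The distances are integers or infinite, so failing the bound everywhere pushes the infimum up to
`k + 1`. -/
theorem exists_mem_of_setDist_le {d : G → G → ℕ∞} {x : G} {Y : Set G} {k : ℕ}
    (h : setDist d x Y ≤ k) : ∃ y ∈ Y, d x y ≤ k := by
  by_contra! hc
  have : ((k + 1 : ℕ) : ℝ≥0∞) ≤ setDist d x Y := by
    refine le_iInf₂ fun y hy => ?_
    have h1 : ((k + 1 : ℕ) : ℕ∞) ≤ d x y := by
      push_cast
      exact Order.add_one_le_of_lt (hc y hy)
    exact_mod_cast ENat.toENNReal_mono h1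
  have h2 := this.trans h
  norm_cast at h2
  omega

theorem setDist_le_of_mem {d : G → G → ℕ∞} {x y : G} {Y : Set G} {k : ℕ} (hy : y ∈ Y)
    (h : d x y ≤ k) : setDist d x Y ≤ k := by
  refine (iInf₂_le y hy).trans ?_
  exact_mod_cast ENat.toENNReal_mono h

theorem exists_mem_of_haus_le {d : G → G → ℕ∞} {Y Z : Set G} {k : ℕ} (h : haus d Y Z ≤ k)
    {y : G} (hy : y ∈ Y) : ∃ z ∈ Z, d y z ≤ (k + 1 : ℕ) := by
  -- The slack of `1` provides an admissible `ε` without asking whether the infimum is attained.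
  have hlt : haus d Y Z < (k + 1 : ℕ) := h.trans_lt (by exact_mod_cast Nat.lt_succ_self k)
  obtain ⟨ε, ⟨-, h1, -⟩, hε⟩ := sInf_lt_iff.mp hlt
  exact exists_mem_of_setDist_le ((h1 hy).trans hε.le)

end Hausdorff

/-! ### Convolutions and their two tapes. -/

section Convolution

variable {A : Type*}

/-- The letters of the first tape of a padded pair. -/
def Pad.fst : Pad A → Option A
  | both a _ => some a
  | left a => some a
  | right _ => none

/-- The letters of the second tape of a padded pair. -/
def Pad.snd : Pad A → Option A
  | both _ b => some b
  | left _ => none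
  | right b => some b

/-- The first tape of a word over the padded alphabet. -/
def tapeFst (c : List (Pad A)) : List A := c.filterMap Pad.fst

/-- The second tape of a word over the padded alphabet. -/
def tapeSnd (c : List (Pad A)) : List A := c.filterMap Pad.snd

theorem tapeFst_append (c d : List (Pad A)) : tapeFst (c ++ d) = tapeFst c ++ tapeFst d :=
  List.filterMap_append

theorem tapeSnd_append (c d : List (Pad A)) : tapeSnd (c ++ d) = tapeSnd c ++ tapeSnd d :=
  List.filterMap_append

theorem length_tapeFst_le (c : List (Pad A)) : (tapeFst c).length ≤ c.length :=
  List.length_filterMap_le _ _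

theorem length_tapeSnd_le (c : List (Pad A)) : (tapeSnd c).length ≤ c.length :=
  List.length_filterMap_le _ _

theorem conv_nil_right (u : List A) : conv u [] = u.map Pad.left := by
  induction u with
  | nil => rfl
  | cons a u ih => rw [conv, ih, List.map_cons]

theorem tapeFst_conv (u v : List A) : tapeFst (conv u v) = u := by
  induction u generalizing v with
  | nil => simp [conv, tapeFst, List.filterMap_map, Function.comp_def, Pad.fst]
  | cons a u ih =>
    obtain _ | ⟨b, v⟩ := v
    · simpa [conv, tapeFst, Pad.fst] using ih []
    · simpa [conv, tapeFst, Pad.fst] using ih v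

theorem tapeSnd_conv (u v : List A) : tapeSnd (conv u v) = v := by
  induction u generalizing v with
  | nil => simp [conv, tapeSnd, List.filterMap_map, Function.comp_def, Pad.snd]
  | cons a u ih =>
    obtain _ | ⟨b, v⟩ := v
    · simpa [conv, tapeSnd, Pad.snd] using ih []
    · simpa [conv, tapeSnd, Pad.snd] using ih v

theorem conv_take (u v : List A) (n : ℕ) : (conv u v).take n = conv (u.take n) (v.take n) := by
  induction n generalizing u v with
  | zero => simp [conv]
  | succ n ih =>
    obtain _ | ⟨a, u⟩ := u
    · simp [conv]
    · obtain _ | ⟨b, v⟩ := v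
      · simpa [conv] using ih u []
      · simpa [conv] using ih u v

/-- The language of all convolutions of two words. -/
def convLang (A : Type*) : Language (Pad A) := {c | ∃ u v : List A, c = conv u v}

theorem mem_convLang {c : List (Pad A)} :
    c ∈ convLang A ↔ c = conv (tapeFst c) (tapeSnd c) := by
  refine ⟨?_, fun h => ⟨_, _, h⟩⟩
  rintro ⟨u, v, rfl⟩
  rw [tapeFst_conv, tapeSnd_conv]

end Convolution

/-! ### Regularity through finiteness of the set of left quotients. -/

section Regular

variable {A B : Type*}

theorem leftQuotient_cons (L : Language A) (a : A) (x : List A) :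
    L.leftQuotient (a :: x) = (L.leftQuotient [a]).leftQuotient x :=
  L.leftQuotient_append [a] x

/-- A language is regular if it lies in a finite family of languages that is closed under
left quotients by letters. -/
theorem isRegular_of_finite_of_closed {S : Set (Language A)} (hS : S.Finite)
    (h : ∀ L ∈ S, ∀ a, L.leftQuotient [a] ∈ S) {L : Language A} (hL : L ∈ S) : L.IsRegular := by
  refine .of_finite_range_leftQuotient (hS.subset ?_)
  rintro _ ⟨x, rfl⟩
  induction x generalizing L with
  | nil => exact hL
  | cons a x ih => rw [leftQuotient_cons]; exact ih (h L hL a)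

/-- A word that can be completed to a word of a regular language can be completed by a word of
bounded length. -/
theorem exists_short_completion {L : Language A} (hL : L.IsRegular) :
    ∃ c : ℕ, ∀ x y : List A, x ++ y ∈ L → ∃ z : List A, z.length ≤ c ∧ x ++ z ∈ L := by
  classical
  -- The length of a chosen word of each quotient, with `0` for the empty one; a regular language
  -- has finitely many quotients.
  let f : Language A → ℕ := fun M => if h : ∃ z, z ∈ M then h.choose.length else 0
  obtain ⟨c, hc⟩ := (hL.finite_range_leftQuotient.image f).bddAbove
  refine ⟨c, fun x y hy => ?_⟩
  have h : ∃ z, z ∈ L.leftQuotient x := ⟨y, hy⟩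
  refine ⟨h.choose, ?_, h.choose_spec⟩
  have := hc ⟨_, ⟨x, rfl⟩, rfl⟩
  rwa [show f (L.leftQuotient x) = h.choose.length from dif_pos h] at this

theorem mem_convLang_both {a b : A} {c : List (Pad A)} :
    Pad.both a b :: c ∈ convLang A ↔ c ∈ convLang A := by
  simp [mem_convLang, tapeFst, tapeSnd, Pad.fst, Pad.snd, conv]

theorem mem_convLang_left {a : A} {c : List (Pad A)} :
    Pad.left a :: c ∈ convLang A ↔ ∃ v : List A, c = v.map Pad.left := by
  constructor
  · rintro ⟨_ | ⟨a', u⟩, v, h⟩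
    · cases v <;> simp [conv] at h
    · obtain _ | ⟨b, v⟩ := v
      · rw [conv, conv_nil_right] at h
        exact ⟨u, (List.cons.inj h).2⟩
      · simp [conv] at h
  · rintro ⟨v, rfl⟩
    exact ⟨a :: v, [], by rw [conv_nil_right, List.map_cons]⟩

theorem mem_convLang_right {a : A} {c : List (Pad A)} :
    Pad.right a :: c ∈ convLang A ↔ ∃ v : List A, c = v.map Pad.right := by
  constructor
  · rintro ⟨_ | ⟨a', u⟩, v, h⟩
    · obtain _ | ⟨b, v⟩ := v
      · simp [conv] at h
      · exact ⟨v, (List.cons.inj h).2⟩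
    · cases v <;> simp [conv] at h
  · rintro ⟨v, rfl⟩
    exact ⟨[], a :: v, rfl⟩

theorem leftQuotient_eq_zero {L : Language A} {x : List A} (h : ∀ y, x ++ y ∉ L) :
    L.leftQuotient x = 0 := by
  ext y
  exact ⟨fun hy => (h y hy).elim, fun hy => (Language.notMem_zero y hy).elim⟩

theorem leftQuotient_zero (x : List A) : (0 : Language A).leftQuotient x = 0 :=
  leftQuotient_eq_zero fun _ => Language.notMem_zero _

/-- The image of a language under an injective map of alphabets. -/
def mapLang (f : A → B) (L : Language A) : Language B := {w | ∃ u ∈ L, w = u.map f}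

theorem leftQuotient_mapLang {f : A → B} (hf : Function.Injective f) (L : Language A) (a : A) :
    (mapLang f L).leftQuotient [f a] = mapLang f (L.leftQuotient [a]) := by
  ext w
  constructor
  · rintro ⟨_ | ⟨b, u⟩, hu, h⟩
    · simp at h
    · obtain ⟨h₁, h₂⟩ := List.cons.inj h
      obtain rfl := hf h₁
      exact ⟨u, hu, h₂⟩
  · rintro ⟨u, hu, rfl⟩
    exact ⟨a :: u, hu, rfl⟩

theorem leftQuotient_mapLang_of_notMem {f : A → B} (L : Language A) {b : B}
    (hb : b ∉ Set.range f) : (mapLang f L).leftQuotient [b] = 0 := by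
  refine leftQuotient_eq_zero ?_
  rintro w ⟨_ | ⟨a, u⟩, -, h⟩
  · simp at h
  · exact hb ⟨a, (List.cons.inj h).1.symm⟩

/-- The quotients of the image are images of quotients, or empty when a letter outside the range of
`f` is read. -/
theorem isRegular_mapLang {f : A → B} (hf : Function.Injective f) {L : Language A}
    (hL : L.IsRegular) : (mapLang f L).IsRegular := by
  refine isRegular_of_finite_of_closed
    (S := insert 0 (mapLang f '' Set.range L.leftQuotient))
    ((hL.finite_range_leftQuotient.image _).insert _) ?_ (Or.inr ⟨L, ⟨[], rfl⟩, rfl⟩)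
  rintro _ (rfl | ⟨_, ⟨x, rfl⟩, rfl⟩) b
  · exact Or.inl (leftQuotient_zero _)
  · by_cases hb : b ∈ Set.range f
    · obtain ⟨a, rfl⟩ := hb
      rw [leftQuotient_mapLang hf]
      exact Or.inr ⟨_, ⟨x ++ [a], rfl⟩, by rw [Language.leftQuotient_append]⟩
    · exact Or.inl (leftQuotient_mapLang_of_notMem _ hb)

/-- Once padding starts on one tape it must continue to the end, so a quotient by a letter is the
language itself or a set of words padded on one fixed tape. -/
theorem isRegular_convLang : (convLang A).IsRegular := by
  have htop : (⊤ : Language A).IsRegular := by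
    refine isRegular_of_finite_of_closed (Set.finite_singleton (⊤ : Language A)) ?_ rfl
    rintro _ rfl a
    rfl
  have hl : Function.Injective (Pad.left : A → Pad A) := fun _ _ => Pad.left.inj
  have hr : Function.Injective (Pad.right : A → Pad A) := fun _ _ => Pad.right.inj
  refine isRegular_of_finite_of_closed
    (S := insert (convLang A) (Set.range (mapLang Pad.left ⊤ : Language (Pad A)).leftQuotient ∪
      Set.range (mapLang Pad.right ⊤ : Language (Pad A)).leftQuotient))
    (((isRegular_mapLang hl htop).finite_range_leftQuotient.union
      (isRegular_mapLang hr htop).finite_range_leftQuotient).insert _) ?_ (Or.inl rfl)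
  rintro _ (rfl | ⟨x, rfl⟩ | ⟨x, rfl⟩) a
  · obtain ⟨a, b⟩ | a | a := a
    · left; ext c; exact mem_convLang_both
    · right; left
      refine ⟨[], ?_⟩
      ext c
      refine Iff.trans ?_ mem_convLang_left.symm
      exact ⟨fun ⟨u, _, h⟩ => ⟨u, h⟩, fun ⟨u, h⟩ => ⟨u, trivial, h⟩⟩
    · right; right
      refine ⟨[], ?_⟩
      ext c
      refine Iff.trans ?_ mem_convLang_right.symm
      exact ⟨fun ⟨u, _, h⟩ => ⟨u, h⟩, fun ⟨u, h⟩ => ⟨u, trivial, h⟩⟩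
  · exact Or.inr (Or.inl ⟨x ++ [a], Language.leftQuotient_append _ _ _⟩)
  · exact Or.inr (Or.inr ⟨x ++ [a], Language.leftQuotient_append _ _ _⟩)

end Regular

/-! ### Automatic structures and the synchronous fellow traveller property. -/

section FellowTraveller

variable {G : Type*} [Group G] {A : Type*}

/-- The words `u` and `v` (synchronously) `K`-fellow travel. -/
def FellowTravel (π : FreeMonoid A →* G) (K : ℕ) (u v : List A) : Prop :=
  ∀ n : ℕ, wordDist π (wordVal π (u.take n)) (wordVal π (v.take n)) ≤ K

theorem FellowTravel.symm {π : FreeMonoid A →* G} {K : ℕ} {u v : List A}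
    (h : FellowTravel π K u v) : FellowTravel π K v u := fun n => by
  rw [wordDist_comm]; exact h n

theorem FellowTravel.trans {π : FreeMonoid A →* G} {K M : ℕ} {u v w : List A}
    (h₁ : FellowTravel π K u v) (h₂ : FellowTravel π M v w) : FellowTravel π (K + M) u w :=
  fun n => wordDist_triangle (h₁ n) (h₂ n)

theorem FellowTravel.mono {π : FreeMonoid A →* G} {K M : ℕ} {u v : List A}
    (h : FellowTravel π K u v) (hKM : K ≤ M) : FellowTravel π M u v :=
  fun n => wordDist_mono (h n) hKM

/-- The words of an automatic structure that are related by a fixed multiplier fellow travel. -/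
theorem IsAutomatic.exists_fellowTravel_of_multiplier {π : FreeMonoid A →* G} {L : Language A}
    (hL : IsAutomatic π L) (x : Option A) :
    ∃ K : ℕ, ∀ u ∈ L, ∀ v ∈ L, wordVal π v = wordVal π (u ++ x.toList) →
      FellowTravel π K u v := by
  obtain ⟨c, hc⟩ := exists_short_completion (hL.multiplier x)
  refine ⟨c + 1 + c, fun u hu v hv huv n => ?_⟩
  -- Cut the convolution after `n` letters and complete it briefly inside the multiplier language.
  -- The two tapes of `z`, joined by `x`, give a path of length at most `c + 1 + c` between the two
  -- prefixes.
  obtain ⟨z, hz, u', hu', v', hv', huv', h⟩ := hc ((conv u v).take n) ((conv u v).drop n)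
    (by rw [List.take_append_drop]; exact ⟨u, hu, v, hv, huv, rfl⟩)
  rw [conv_take] at h
  have h₁ : u' = u.take n ++ tapeFst z := by
    rw [← tapeFst_conv u' v', ← h, tapeFst_append, tapeFst_conv]
  have h₂ : v' = v.take n ++ tapeSnd z := by
    rw [← tapeSnd_conv u' v', ← h, tapeSnd_append, tapeSnd_conv]
  have hx : x.toList.length ≤ 1 := by cases x <;> simp
  have d₁ := wordDist_mul_wordVal π (wordVal π (u.take n)) (tapeFst z ++ x.toList)
  have d₂ := wordDist_mul_wordVal π (wordVal π (v.take n)) (tapeSnd z)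
  rw [← wordVal_append] at d₁ d₂
  rw [← List.append_assoc, ← h₁, ← huv'] at d₁
  rw [← h₂, wordDist_comm] at d₂
  refine wordDist_mono (wordDist_triangle d₁ d₂) ?_
  have := length_tapeFst_le z
  have := length_tapeSnd_le z
  rw [List.length_append]
  omega

/-- The words of an automatic structure that represent elements at bounded distance fellow
travel. -/
theorem IsAutomatic.exists_fellowTravel [Finite A] {π : FreeMonoid A →* G} {L : Language A}
    (hL : IsAutomatic π L) (r : ℕ) :
    ∃ K : ℕ, ∀ u ∈ L, ∀ v ∈ L, wordDist π (wordVal π u) (wordVal π v) ≤ r →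
      FellowTravel π K u v := by
  choose f hf using hL.exists_fellowTravel_of_multiplier
  obtain ⟨K, hK⟩ := (Set.finite_range f).bddAbove
  have hstep : ∀ x, ∀ u ∈ L, ∀ v ∈ L, wordVal π v = wordVal π (u ++ Option.toList x) →
      FellowTravel π K u v := fun x u hu v hv h => (hf x u hu v hv h).mono (hK ⟨x, rfl⟩)
  -- One `K` for each edge of a path between the values, and one for the final comparison of two
  -- words with the same value.
  refine ⟨K * r + K, fun u hu v hv huv => ?_⟩
  obtain ⟨l, hl, h⟩ := wordDist_le_iff.mp huv
  refine FellowTravel.mono (K := K * l.length + K) ?_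
    (Nat.add_le_add_right (Nat.mul_le_mul_left K hl) K)
  clear hl huv
  induction l generalizing u with
  | nil =>
    rw [signedVal_nil, mul_one] at h
    refine (hstep none u hu v hv ?_).mono (by omega)
    rw [Option.toList_none, List.append_nil, h]
  | cons a l ih =>
    rw [signedVal_cons, ← mul_assoc] at h
    obtain ⟨u', hu', hval⟩ := hL.onto (wordVal π u * signedVal π [a])
    rw [← hval] at h
    refine FellowTravel.mono (FellowTravel.trans (v := u') (K := K) ?_ (ih u' hu' h)) ?_
    · obtain ⟨a, _ | _⟩ := a
      · refine (hstep (some a) u' hu' u hu ?_).symm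
        rw [wordVal_append, hval, signedVal_singleton_false, Option.toList_some, wordVal_cons,
          wordVal_nil, mul_one, inv_mul_cancel_right]
      · refine hstep (some a) u hu u' hu' ?_
        rw [wordVal_append, hval, signedVal_singleton_true, Option.toList_some, wordVal_cons,
          wordVal_nil, mul_one]
    · rw [List.length_cons, Nat.mul_succ]; omega

/-- A rational section with the fellow traveller property is an automatic structure. -/
theorem IsRationalSection.isAutomatic [Finite A] {π : FreeMonoid A →* G} {L : Language A}
    (hL : IsRationalSection π L) {K : ℕ}
    (hK : ∀ u ∈ L, ∀ v ∈ L, wordDist π (wordVal π u) (wordVal π v) ≤ 1 → FellowTravel π K u v) :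
    IsAutomatic π L := by
  refine ⟨hL, fun x => ?_⟩
  set S : Language (Pad A) :=
    {c | ∃ u ∈ L, ∃ v ∈ L, wordVal π v = wordVal π (u ++ x.toList) ∧ c = conv u v} with hS
  have hmem : ∀ c, c ∈ S ↔ c ∈ convLang A ∧ tapeFst c ∈ L ∧ tapeSnd c ∈ L ∧
      wordVal π (tapeSnd c) = wordVal π (tapeFst c) * wordVal π x.toList := by
    intro c
    constructor
    · rintro ⟨u, hu, v, hv, h, rfl⟩
      rw [tapeFst_conv, tapeSnd_conv, ← wordVal_append]
      exact ⟨⟨u, v, rfl⟩, hu, hv, h⟩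
    · rintro ⟨h₁, h₂, h₃, h₄⟩
      exact ⟨_, h₂, _, h₃, by rw [h₄, wordVal_append], mem_convLang.mp h₁⟩
  -- The quotient of `S` by `c` depends only on the quotients of `convLang A` by `c` and of `L` by
  -- the two tapes, and on the group element between the tape values. If `c` can be completed in
  -- `S`, fellow travelling puts that element in the ball of radius `K`.
  let F : Language (Pad A) × Language A × Language A × G → Language (Pad A) := fun d =>
    {z | z ∈ d.1 ∧ tapeFst z ∈ d.2.1 ∧ tapeSnd z ∈ d.2.2.1 ∧
      wordVal π (tapeSnd z) = d.2.2.2 * wordVal π (tapeFst z) * wordVal π x.toList}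
  have hfin : (insert 0 (F '' (Set.range (convLang A).leftQuotient ×ˢ
      Set.range L.leftQuotient ×ˢ Set.range L.leftQuotient ×ˢ
        {g : G | wordDist π 1 g ≤ K}))).Finite := by
    refine Set.Finite.insert _ (Set.Finite.image _ ?_)
    exact isRegular_convLang.finite_range_leftQuotient.prod
      (hL.regular.finite_range_leftQuotient.prod
        (hL.regular.finite_range_leftQuotient.prod (finite_ball π K)))
  refine .of_finite_range_leftQuotient (hfin.subset ?_)
  rintro _ ⟨c, rfl⟩
  by_cases hc : ∃ z, c ++ z ∈ S
  · right
    refine ⟨(_, _, _, (wordVal π (tapeSnd c))⁻¹ * wordVal π (tapeFst c)),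
      ⟨⟨c, rfl⟩, ⟨tapeFst c, rfl⟩, ⟨tapeSnd c, rfl⟩, ?_⟩, ?_⟩
    · obtain ⟨z, u, hu, v, hv, h, hz⟩ := hc
      have h₁ : c = conv (u.take c.length) (v.take c.length) := by
        rw [← conv_take, ← hz, List.take_left]
      have h₂ : wordDist π (wordVal π u) (wordVal π v) ≤ 1 := by
        rw [h, wordVal_append]
        refine wordDist_mono (wordDist_mul_wordVal _ _ _) (n := 1) ?_
        cases x <;> simp
      have h₃ := (hK u hu v hv h₂).symm c.length
      rw [← tapeFst_conv (u.take c.length) (v.take c.length), ← h₁] at h₃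
      nth_rw 1 [← tapeSnd_conv (u.take c.length) (v.take c.length), ← h₁] at h₃
      exact wordDist_inv_mul_le h₃
    · ext z
      rw [Language.mem_leftQuotient, hmem, tapeFst_append, tapeSnd_append, wordVal_append,
        wordVal_append]
      refine and_congr Iff.rfl (and_congr Iff.rfl (and_congr Iff.rfl ?_))
      simp only [mul_assoc, eq_inv_mul_iff_mul_eq]
  · exact Or.inl (leftQuotient_eq_zero (not_exists.mp hc))

end FellowTraveller

/-! ### The union of two languages over the disjoint alphabet. -/

section Union

variable {G : Type*} [Group G] {A B : Type*} {π₁ : FreeMonoid A →* G} {π₂ : FreeMonoid B →* G}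

theorem wordVal_unionHom_inl (u : List A) :
    wordVal (unionHom π₁ π₂) (u.map Sum.inl) = wordVal π₁ u := by
  induction u with
  | nil => rw [List.map_nil, wordVal_nil, wordVal_nil]
  | cons a u ih => rw [List.map_cons, wordVal_cons, wordVal_cons, ih]; simp [unionHom]

theorem wordVal_unionHom_inr (v : List B) :
    wordVal (unionHom π₁ π₂) (v.map Sum.inr) = wordVal π₂ v := by
  induction v with
  | nil => rw [List.map_nil, wordVal_nil, wordVal_nil]
  | cons a u ih => rw [List.map_cons, wordVal_cons, wordVal_cons, ih]; simp [unionHom]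

theorem surjective_unionHom (h : Function.Surjective π₁) :
    Function.Surjective (unionHom π₁ π₂) := fun g => by
  obtain ⟨w, rfl⟩ := exists_wordVal_eq h g
  exact ⟨FreeMonoid.ofList (w.map Sum.inl), wordVal_unionHom_inl w⟩

theorem isRationalSection_union {L₁ : Language A} {L₂ : Language B}
    (h : IsRationalSection π₁ L₁) (h₂ : L₂.IsRegular) :
    IsRationalSection (unionHom π₁ π₂) (unionLang L₁ L₂) where
  surjective := surjective_unionHom h.surjective
  regular := (isRegular_mapLang Sum.inl_injective h.regular).add
    (isRegular_mapLang Sum.inr_injective h₂)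
  onto g := by
    obtain ⟨w, hw, rfl⟩ := h.onto g
    exact ⟨_, Or.inl ⟨w, hw, rfl⟩, wordVal_unionHom_inl w⟩

end Union

/-! ### The standard language `L₂''(H)`: regularity and shadows. -/

section Standard

variable {G : Type*} [Group G] {B : Type*}

theorem rewriteWord_nil (g : ℕ → List (B × Bool)) : rewriteWord [] g = [] := rfl

theorem rewriteWord_cons (b : B) (w : List B) (g : ℕ → List (B × Bool)) :
    rewriteWord (b :: w) g = (FreeGroup.invRev (g 0) ++ (b, true) :: g 1) ::
      rewriteWord w fun i => g (i + 1) := by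
  simp [rewriteWord, List.mapIdx_cons]

theorem length_rewriteWord (w : List B) (g : ℕ → List (B × Bool)) :
    (rewriteWord w g).length = w.length := by
  simp [rewriteWord]

/-- The correcting words cancel between consecutive letters. -/
theorem prod_take_rewriteWord (π : FreeMonoid B →* G) (w : List B) (g : ℕ → List (B × Bool))
    {i : ℕ} (hi : i ≤ w.length) :
    (((rewriteWord w g).take i).map (signedVal π)).prod =
      (signedVal π (g 0))⁻¹ * (wordVal π (w.take i) * signedVal π (g i)) := by
  induction i generalizing w g with
  | zero => simp [wordVal_nil]
  | succ i ih =>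
    obtain _ | ⟨b, w⟩ := w
    · simp at hi
    rw [rewriteWord_cons, List.take_succ_cons, List.map_cons, List.prod_cons,
      ih w _ (by simpa using hi), signedVal_append, signedVal_invRev, signedVal_cons,
      signedVal_singleton_true, List.take_succ_cons, wordVal_cons]
    group

/-- `cs` is the rewriting of a word of `L` by correcting words of length at most `k`, the first of
which is `g` and the last of which is empty. -/
def IsRewriting (k : ℕ) : Language B → List (B × Bool) → List (List (B × Bool)) → Prop
  | L, g, [] => [] ∈ L ∧ g = []
  | L, g, c :: cs => ∃ (b : B) (g' : List (B × Bool)), g'.length ≤ k ∧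
      c = FreeGroup.invRev g ++ (b, true) :: g' ∧ IsRewriting k (L.leftQuotient [b]) g' cs

theorem isRewriting_iff {k : ℕ} {L : Language B} {g₀ : List (B × Bool)}
    {cs : List (List (B × Bool))} :
    IsRewriting k L g₀ cs ↔ ∃ w ∈ L, ∃ g : ℕ → List (B × Bool), g 0 = g₀ ∧ g w.length = [] ∧
      (∀ i < w.length, (g (i + 1)).length ≤ k) ∧ cs = rewriteWord w g := by
  induction cs generalizing L g₀ with
  | nil =>
    constructor
    · rintro ⟨h, rfl⟩
      exact ⟨[], h, fun _ => [], rfl, rfl, by simp, rfl⟩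
    · rintro ⟨w, hw, g, rfl, h, -, hc⟩
      have := congrArg List.length hc
      rw [length_rewriteWord, List.length_nil, eq_comm, List.length_eq_zero_iff] at this
      subst this
      exact ⟨hw, h⟩
  | cons c cs ih =>
    constructor
    · rintro ⟨b, g', hg', rfl, h⟩
      obtain ⟨w, hw, g, rfl, hlast, hshort, rfl⟩ := ih.mp h
      refine ⟨b :: w, hw, fun i => Nat.casesOn i g₀ g, rfl, hlast, ?_, ?_⟩
      · rintro (_ | i) hi
        · exact hg'
        · exact hshort i (by simpa using hi)
      · rw [rewriteWord_cons]; rfl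
    · rintro ⟨_ | ⟨b, w⟩, hw, g, rfl, hlast, hshort, hc⟩
      · simp [rewriteWord_nil] at hc
      · rw [rewriteWord_cons] at hc
        obtain ⟨rfl, rfl⟩ := List.cons.inj hc
        refine ⟨b, g 1, hshort 0 (by simp), rfl, ih.mpr ⟨w, hw, fun i => g (i + 1), rfl, hlast,
          fun i hi => hshort (i + 1) (by simpa using hi), rfl⟩⟩

variable {π : FreeMonoid B →* G} {L : Language B} {H : Subgroup G} {k : ℕ}

theorem coe_wordVal_stdHom (c : List (stdGens π L H k)) :
    ((wordVal (stdHom π L H k) c : H) : G) = ((c.map Subtype.val).map (signedVal π)).prod := by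
  induction c with
  | nil => simp [wordVal_nil]
  | cons a c ih => rw [wordVal_cons, Subgroup.coe_mul, ih]; simp [stdHom]

/-- The requirement that corrected prefixes lie in `H` comes for free: each is a product of letters
of the alphabet, all of which represent elements of `H`. Only letter-by-letter conditions remain, as
a finite automaton needs. -/
theorem mem_stdLang_iff {c : List (stdGens π L H k)} :
    c ∈ stdLang π L H k ↔ IsRewriting k L [] (c.map Subtype.val) := by
  rw [isRewriting_iff]
  constructor
  · rintro ⟨w, hw, g, hg, hc⟩
    exact ⟨w, hw.1, g, hg.first, hg.last, fun i hi => hg.short _ hi, hc⟩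
  · rintro ⟨w, hw, g, hfirst, hlast, hshort, hc⟩
    have hmem : ∀ i ≤ w.length, wordVal π (w.take i) * signedVal π (g i) ∈ H := by
      intro i hi
      have := prod_take_rewriteWord π w g hi
      rw [hfirst, signedVal_nil, inv_one, one_mul, ← hc, ← List.map_take,
        ← coe_wordVal_stdHom] at this
      rw [← this]
      exact SetLike.coe_mem _
    refine ⟨w, ⟨hw, ?_⟩, g, ⟨hfirst, hlast, ?_, hmem⟩, hc⟩
    · have := hmem _ le_rfl
      rwa [hlast, signedVal_nil, mul_one, List.take_length] at this
    · rintro (_ | i) hi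
      · rw [hfirst]; simp
      · exact hshort i hi

/-- A subset construction. A state is a set of pairs (quotient of `L`, pending correcting word);
sets are needed because a letter, as a word, may split as `g⁻¹ b g'` in several ways. -/
theorem isRegular_stdLang [Finite B] (hL : L.IsRegular) : (stdLang π L H k).IsRegular := by
  let D : Set (Language B × List (B × Bool)) :=
    Set.range L.leftQuotient ×ˢ {g | g.length ≤ k}
  have hD : D.Finite := hL.finite_range_leftQuotient.prod (List.finite_length_le _ k)
  let F : Set (Language B × List (B × Bool)) → Language (stdGens π L H k) := fun P =>
    {c | ∃ p ∈ P, IsRewriting k p.1 p.2 (c.map Subtype.val)}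
  refine isRegular_of_finite_of_closed (S := F '' D.powerset) (hD.finite_subsets.image F) ?_ ?_
  · rintro _ ⟨P, hP, rfl⟩ a
    refine ⟨{p | ∃ q ∈ P, ∃ b, p.1 = q.1.leftQuotient [b] ∧ p.2.length ≤ k ∧
      a.1 = FreeGroup.invRev q.2 ++ (b, true) :: p.2}, ?_, ?_⟩
    · rintro ⟨_, g⟩ ⟨q, hq, b, rfl, hg, -⟩
      obtain ⟨⟨x, hx⟩, -⟩ := hP hq
      refine ⟨⟨x ++ [b], ?_⟩, hg⟩
      rw [Language.leftQuotient_append, hx]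
    · ext c
      constructor
      · rintro ⟨⟨_, g⟩, ⟨q, hq, b, rfl, hg, ha⟩, h⟩
        exact ⟨q, hq, b, g, hg, ha, h⟩
      · rintro ⟨q, hq, b, g, hg, ha, h⟩
        exact ⟨(_, g), ⟨q, hq, b, rfl, hg, ha⟩, h⟩
  · refine ⟨{(L, [])}, ?_, ?_⟩
    · rintro _ rfl
      exact ⟨⟨[], rfl⟩, by simp⟩
    · ext c
      rw [mem_stdLang_iff]
      constructor
      · rintro ⟨_, rfl, h⟩
        exact h
      · exact fun h => ⟨_, rfl, h⟩

/-- The word `c` over the standard alphabet follows the word `w` at distance at most `k`. -/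
structure IsShadow (c : List (stdGens π L H k)) (w : List B) : Prop where
  length_eq : c.length = w.length
  val_eq : ((wordVal (stdHom π L H k) c : H) : G) = wordVal π w
  near : ∀ n : ℕ, wordDist π ((wordVal (stdHom π L H k) (c.take n) : H) : G) (wordVal π (w.take n)) ≤ k

theorem isShadow_of_isCorrection {c : List (stdGens π L H k)} {w : List B}
    {g : ℕ → List (B × Bool)} (hg : IsCorrection π H k w g)
    (hc : c.map Subtype.val = rewriteWord w g) : IsShadow c w := by
  have hval : ∀ n ≤ w.length, ((wordVal (stdHom π L H k) (c.take n) : H) : G) =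
      wordVal π (w.take n) * signedVal π (g n) := by
    intro n hn
    rw [coe_wordVal_stdHom, List.map_take, hc, prod_take_rewriteWord π w g hn, hg.first,
      signedVal_nil, inv_one, one_mul]
  have hlen : c.length = w.length := by
    rw [← length_rewriteWord w g, ← hc, List.length_map]
  have hend : ((wordVal (stdHom π L H k) c : H) : G) = wordVal π w := by
    have := hval _ le_rfl
    rwa [hg.last, signedVal_nil, mul_one, List.take_length, ← hlen, List.take_length] at this
  refine ⟨hlen, hend, fun n => ?_⟩
  rcases le_total n w.length with hn | hn
  · rw [hval n hn, wordDist_comm]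
    exact wordDist_mono (wordDist_mul_signedVal _ _ _) (hg.short n hn)
  · rw [List.take_of_length_le hn, List.take_of_length_le (hlen.trans_le hn), hend, wordDist_self]
    exact zero_le

theorem exists_isShadow_of_mem_stdLang {c : List (stdGens π L H k)} (hc : c ∈ stdLang π L H k) :
    ∃ w ∈ L, IsShadow c w := by
  obtain ⟨w, hw, g, hg, h⟩ := hc
  exact ⟨w, hw.1, isShadow_of_isCorrection hg h⟩

theorem IsQuasiconvexWith.exists_isCorrection (h : IsQuasiconvexWith π L H k) {w : List B}
    (hw : w ∈ langIn π L H) : ∃ g, IsCorrection π H k w g := by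
  classical
  have hex : ∀ i, ∃ l : List (B × Bool), l.length ≤ k ∧
      wordVal π (w.take i) * signedVal π l ∈ H := by
    intro i
    have := h 1 H.one_mem _ hw.2 w hw.1 (one_mul _) i
    rw [one_mul] at this
    obtain ⟨y, hy, hd⟩ := exists_mem_of_setDist_le this
    obtain ⟨l, hl, rfl⟩ := wordDist_le_iff.mp hd
    exact ⟨l, hl, hy⟩
  choose l hl hmem using hex
  -- Quasiconvexity supplies `l i`; at both ends the empty word is imposed instead, which is allowed
  -- since `1` and the value of `w` lie in `H`.
  refine ⟨fun i => if i = 0 ∨ i = w.length then [] else l i, by simp, by simp, ?_, ?_⟩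
  · intro i _
    split_ifs
    · simp
    · exact hl i
  · intro i _
    split_ifs with hi
    · rw [signedVal_nil, mul_one]
      obtain rfl | rfl := hi
      · rw [List.take_zero, wordVal_nil]; exact H.one_mem
      · rw [List.take_length]; exact hw.2
    · exact hmem i

theorem IsQuasiconvexWith.exists_isShadow (h : IsQuasiconvexWith π L H k) {w : List B}
    (hw : w ∈ langIn π L H) : ∃ c ∈ stdLang π L H k, IsShadow c w := by
  obtain ⟨g, hg⟩ := h.exists_isCorrection hw
  have hmem : ∀ c ∈ rewriteWord w g, c ∈ stdGens π L H k :=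
    fun c hc => ⟨w, hw, g, hg, Or.inl hc⟩
  have hc : ((rewriteWord w g).pmap Subtype.mk hmem).map Subtype.val = rewriteWord w g := by
    rw [List.map_pmap, List.pmap_eq_map, List.map_id']
  exact ⟨_, ⟨w, hw, g, hg, hc⟩, isShadow_of_isCorrection hg hc⟩

end Standard

/-! ### Monotone lattice paths. -/

section Staircase

theorem surjective_of_le_succ {g : ℕ → ℕ} (h₀ : g 0 = 0) (hstep : ∀ k, g (k + 1) ≤ g k + 1)
    (hg : ∀ n, ∃ k, n ≤ g k) : Function.Surjective g := by
  classical
  intro n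
  refine ⟨Nat.find (hg n), (Nat.find_spec (hg n)).antisymm' ?_⟩
  rcases h : Nat.find (hg n) with _ | k
  · rw [h₀]; exact Nat.zero_le n
  · have := Nat.find_min (hg n) (m := k) (by omega)
    have := hstep k
    omega

/-- The staircase under the graph of an unbounded monotone function. -/
theorem exists_staircase {f : ℕ → ℕ} (hf : Monotone f) (h₀ : f 0 = 0) (htop : ∀ n, ∃ i, n ≤ f i) :
    ∃ s t : ℕ → ℕ, Monotone s ∧ Function.Surjective s ∧ Monotone t ∧ Function.Surjective t ∧
      ∀ k, f (s k) ≤ t k ∧ t k ≤ f (s k + 1) := by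
  -- Climb while below `f` at the next column, otherwise move one column right.
  let step : ℕ × ℕ → ℕ × ℕ := fun p => if p.2 < f (p.1 + 1) then (p.1, p.2 + 1) else (p.1 + 1, p.2)
  let S : ℕ → ℕ × ℕ := fun k => step^[k] (0, 0)
  have hS : ∀ k, S (k + 1) = step (S k) := fun k => Function.iterate_succ_apply' _ _ _
  have hcases : ∀ k, ((S k).2 < f ((S k).1 + 1) ∧ (S (k + 1)).1 = (S k).1 ∧
      (S (k + 1)).2 = (S k).2 + 1) ∨ (f ((S k).1 + 1) ≤ (S k).2 ∧
      (S (k + 1)).1 = (S k).1 + 1 ∧ (S (k + 1)).2 = (S k).2) := by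
    intro k
    rw [hS]
    by_cases h : (S k).2 < f ((S k).1 + 1)
    · rw [show step (S k) = ((S k).1, (S k).2 + 1) from if_pos h]
      exact Or.inl ⟨h, rfl, rfl⟩
    · rw [show step (S k) = ((S k).1 + 1, (S k).2) from if_neg h]
      exact Or.inr ⟨not_lt.mp h, rfl, rfl⟩
  have hinv : ∀ k, f (S k).1 ≤ (S k).2 ∧ (S k).2 ≤ f ((S k).1 + 1) := by
    intro k
    induction k with
    | zero => exact ⟨h₀.le, Nat.zero_le _⟩
    | succ k ih =>
      rcases hcases k with ⟨h, h₁, h₂⟩ | ⟨h, h₁, h₂⟩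
      · rw [h₁, h₂]; omega
      · rw [h₁, h₂]
        exact ⟨h, ih.2.trans (hf (Nat.le_succ _))⟩
  have hsum : ∀ k, (S k).1 + (S k).2 = k := by
    intro k
    induction k with
    | zero => rfl
    | succ k ih => rcases hcases k with ⟨-, h₁, h₂⟩ | ⟨-, h₁, h₂⟩ <;> omega
  refine ⟨fun k => (S k).1, fun k => (S k).2, monotone_nat_of_le_succ fun k => ?_,
    surjective_of_le_succ rfl (fun k => ?_) fun n => ?_, monotone_nat_of_le_succ fun k => ?_,
    surjective_of_le_succ rfl (fun k => ?_) fun n => ?_, hinv⟩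
  · rcases hcases k with h | h <;> omega
  · rcases hcases k with h | h <;> omega
  -- The coordinates at time `k` sum to `k`, and the height before column `n` is at most `f (n +
  -- 1)`, so column `n` has been reached by then.
  · refine ⟨n + f (n + 1), ?_⟩
    by_contra hlt
    have h₁ := hsum (n + f (n + 1))
    have h₂ := (hinv (n + f (n + 1))).2
    have h₃ : f ((S (n + f (n + 1))).1 + 1) ≤ f (n + 1) := hf (by omega)
    omega
  · rcases hcases k with h | h <;> omega
  · rcases hcases k with h | h <;> omega
  · obtain ⟨i, hi⟩ := htop n
    refine ⟨i + n, ?_⟩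
    by_contra hlt
    have h₁ := hsum (i + n)
    have h₂ := (hinv (i + n)).1
    have h₃ : f i ≤ f (S (i + n)).1 := hf (by omega)
    omega

end Staircase

/-! ### From nearness of paths to asynchronous fellow travelling. -/

section Paths

variable {G : Type*} [Group G] {A B : Type*} {π : FreeMonoid B →* G}

/-- If the path `q` does not return and the path `p` is close to it, prefix by prefix, then `p` and
`q` asynchronously fellow travel. -/
theorem exists_monotone_near {p q : ℕ → G} {J : ℕ → ℕ} {K₁ K₂ M : ℕ} {C : ℕ → ℕ}
    (hJ₀ : J 0 = 0) (hJ : ∀ n, ∃ i, n ≤ J i)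
    (hnear : ∀ i, wordDist π (p i) (q (J i)) ≤ K₁)
    (hprefix : ∀ i j, wordDist π (p i) (q j) ≤ K₁ → ∀ i' ≤ i, ∃ j' ≤ j,
      wordDist π (p i') (q j') ≤ K₂)
    (hreturn : ∀ (r : ℕ) (j j' : ℕ), wordDist π (q j) (q j') ≤ r → ∀ l, j ≤ l → l ≤ j' →
      wordDist π (q j) (q l) ≤ C r)
    (hstep : ∀ i, wordDist π (p i) (p (i + 1)) ≤ M) :
    ∃ s t : ℕ → ℕ, Monotone s ∧ Function.Surjective s ∧ Monotone t ∧ Function.Surjective t ∧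
      ∀ k, wordDist π (p (s k)) (q (t k)) ≤
        (2 * K₁ + K₂ + C (K₁ + K₂) + C (2 * (2 * K₁ + K₂ + C (K₁ + K₂)) + M) : ℕ) := by
  set f := partialSups J with hf
  have hmax : ∀ i, ∃ i' ≤ i, f i = J i' := by
    intro i
    induction i with
    | zero => exact ⟨0, le_rfl, partialSups_zero J⟩
    | succ i ih =>
      obtain ⟨i', hi', h⟩ := ih
      rcases le_total (f i) (J (i + 1)) with hle | hle
      · exact ⟨i + 1, le_rfl, by rw [hf, partialSups_add_one, sup_eq_right.mpr hle]⟩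
      · exact ⟨i', by omega, by rw [hf, partialSups_add_one, sup_eq_left.mpr hle, ← h]⟩
  have hle : ∀ i, J i ≤ f i := le_partialSups J
  -- The maximum `f i` is attained as `J i'` with `i' ≤ i`. As `p i'` is near both `q (J i')` and
  -- some `q j'` with `j' ≤ J i ≤ J i'`, the path `q` is near itself at `j'` and `J i'`, hence
  -- cannot have strayed at `J i`.
  have hclose : ∀ i, wordDist π (p i) (q (f i)) ≤ (2 * K₁ + K₂ + C (K₁ + K₂) : ℕ) := by
    intro i
    obtain ⟨i', hi', hfi⟩ := hmax i
    obtain ⟨j', hj', h₁⟩ := hprefix i _ (hnear i) i' hi'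
    rw [wordDist_comm] at h₁
    have h₂ : wordDist π (q j') (q (f i)) ≤ (K₁ + K₂ : ℕ) := by
      rw [hfi, add_comm]; exact wordDist_triangle h₁ (hnear i')
    have h₃ := hreturn _ _ _ h₂ (J i) hj' (hle i)
    rw [wordDist_comm] at h₃
    refine wordDist_mono (wordDist_triangle (hnear i) (wordDist_triangle h₃ h₂)) ?_
    omega
  obtain ⟨s, t, hs, hs', ht, ht', h⟩ := exists_staircase f.monotone
    ((partialSups_zero J).trans hJ₀) fun n => (hJ n).imp fun i hi => hi.trans (hle i)
  refine ⟨s, t, hs, hs', ht, ht', fun k => wordDist_triangle (hclose (s k)) ?_⟩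
  -- `t k` lies between consecutive values of `f`, whose vertices on `q` are close because `p` moves
  -- by at most `M`.
  refine hreturn _ _ (f (s k + 1)) ?_ (t k) (h k).1 (h k).2
  have h₁ := hclose (s k)
  rw [wordDist_comm] at h₁
  refine wordDist_mono (wordDist_triangle (wordDist_triangle h₁ (hstep (s k)))
    (hclose (s k + 1))) ?_
  omega

theorem wordDist_take_append (π : FreeMonoid B →* G) (u z : List B) (n : ℕ) :
    wordDist π (wordVal π (u.take n)) (wordVal π ((u ++ z).take n)) ≤ z.length := by
  rw [List.take_append, wordVal_append]
  refine wordDist_mono (wordDist_mul_wordVal _ _ _) ?_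
  rw [List.length_take]
  exact min_le_right _ _

/-- The paths labelled by the words of an automatic structure do not return: if two of their
vertices are close, they stay close in between. -/
theorem IsAutomatic.exists_no_return [Finite B] {L : Language B} (hL : IsAutomatic π L) (r : ℕ) :
    ∃ C : ℕ, ∀ v ∈ L, ∀ j j', wordDist π (wordVal π (v.take j)) (wordVal π (v.take j')) ≤ r →
      ∀ l, j ≤ l → l ≤ j' → wordDist π (wordVal π (v.take j)) (wordVal π (v.take l)) ≤ C := by
  obtain ⟨c, hc⟩ := exists_short_completion hL.regular
  obtain ⟨K, hK⟩ := hL.exists_fellowTravel (c + r + c)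
  refine ⟨c + K + c, fun v hv j j' hd l hjl hlj => ?_⟩
  obtain ⟨z, hz, hvz⟩ := hc (v.take j) (v.drop j) (by rwa [List.take_append_drop])
  obtain ⟨z', hz', hvz'⟩ := hc (v.take j') (v.drop j') (by rwa [List.take_append_drop])
  have h₁ := wordDist_mono (wordDist_mul_wordVal π (wordVal π (v.take j)) z) hz
  have h₂ := wordDist_mono (wordDist_mul_wordVal π (wordVal π (v.take j')) z') hz'
  rw [← wordVal_append] at h₁ h₂
  rw [wordDist_comm] at h₁
  -- Compare the two completed prefixes at time `l`: the first has passed `j` and is within `c` of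
  -- it, the second is within `c` of the prefix of `v` of length `l`.
  have h₃ := hK _ hvz _ hvz' (wordDist_triangle (wordDist_triangle h₁ hd) h₂) l
  have h₄ := wordDist_mono (wordDist_take_append π (v.take j) z l) hz
  have h₅ := wordDist_mono (wordDist_take_append π (v.take j') z' l) hz'
  rw [List.take_take, min_eq_right hjl] at h₄
  rw [List.take_take, min_eq_left hlj, wordDist_comm] at h₅
  exact wordDist_triangle (wordDist_triangle h₄ h₃) h₅

variable [Finite B] {σ : FreeMonoid A →* G} {L₁ : Language A} {L₂ : Language B}

/-- A word of `L₂` with the same value as `u` mediates: it is near `u` by `hN` and fellow travels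
`v`. -/
theorem IsAutomatic.exists_near_of_near (hL₂ : IsAutomatic π L₂) {N : ℕ}
    (hN : ∀ u ∈ L₁, ∀ v ∈ L₂, wordVal π v = wordVal σ u →
      ∀ i, ∃ j, wordDist π (wordVal σ (u.take i)) (wordVal π (v.take j)) ≤ N) (r : ℕ) :
    ∃ K : ℕ, ∀ u ∈ L₁, ∀ v ∈ L₂, wordDist π (wordVal σ u) (wordVal π v) ≤ r →
      ∀ i, ∃ j, wordDist π (wordVal σ (u.take i)) (wordVal π (v.take j)) ≤ K := by
  obtain ⟨K, hK⟩ := hL₂.exists_fellowTravel r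
  refine ⟨N + K, fun u hu v hv huv i => ?_⟩
  obtain ⟨w, hw, hval⟩ := hL₂.onto (wordVal σ u)
  obtain ⟨j, hj⟩ := hN u hu w hw hval i
  rw [← hval] at huv
  exact ⟨j, wordDist_triangle hj (hK w hw v hv huv j)⟩

/-- Both prefixes are completed by short words, which disturbs end points and truncations boundedly.
This supplies `hprefix` in `exists_monotone_near`. -/
theorem IsAutomatic.exists_near_of_near_of_prefix [Finite A] (hL₁ : L₁.IsRegular) (hL₂ : IsAutomatic π L₂)
    {N : ℕ} (hN : ∀ u ∈ L₁, ∀ v ∈ L₂, wordVal π v = wordVal σ u →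
      ∀ i, ∃ j, wordDist π (wordVal σ (u.take i)) (wordVal π (v.take j)) ≤ N) (r : ℕ) :
    ∃ K : ℕ, ∀ u x, u ++ x ∈ L₁ → ∀ v y, v ++ y ∈ L₂ →
      wordDist π (wordVal σ u) (wordVal π v) ≤ r →
      ∀ i, ∃ j, wordDist π (wordVal σ (u.take i)) (wordVal π (v.take j)) ≤ K := by
  obtain ⟨M, hM⟩ := exists_wordDist_map_le (MonoidHom.id G) σ hL₂.surjective
  obtain ⟨c₁, hc₁⟩ := exists_short_completion hL₁
  obtain ⟨c₂, hc₂⟩ := exists_short_completion hL₂.regular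
  obtain ⟨K, hK⟩ := hL₂.exists_near_of_near hN (M * c₁ + r + c₂)
  refine ⟨M * c₁ + K + c₂, fun u x hx v y hy huv i => ?_⟩
  obtain ⟨x', hx', hux⟩ := hc₁ u x hx
  obtain ⟨y', hy', hvy⟩ := hc₂ v y hy
  have h₁ := hM _ _ _ (wordDist_mono (wordDist_mul_wordVal σ (wordVal σ u) x') hx')
  have h₂ := wordDist_mono (wordDist_mul_wordVal π (wordVal π v) y') hy'
  rw [← wordVal_append] at h₁ h₂
  rw [wordDist_comm] at h₁
  obtain ⟨j, hj⟩ := hK _ hux _ hvy (wordDist_triangle (wordDist_triangle h₁ huv) h₂) i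
  have h₃ := hM _ _ _ (wordDist_mono (wordDist_take_append σ u x' i) hx')
  have h₄ := wordDist_mono (wordDist_take_append π v y' j) hy'
  rw [wordDist_comm] at h₄
  exact ⟨j, wordDist_triangle (wordDist_triangle h₃ hj) h₄⟩

/-- If the paths of `L₁` stay close to the paths of the automatic structure `L₂` with the same
value, then they asynchronously fellow travel them. -/
theorem IsAutomatic.exists_async [Finite A] (hL₁ : L₁.IsRegular) (hL₂ : IsAutomatic π L₂)
    {N : ℕ} (hN : ∀ u ∈ L₁, ∀ v ∈ L₂, wordVal π v = wordVal σ u →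
      ∀ i, ∃ j, wordDist π (wordVal σ (u.take i)) (wordVal π (v.take j)) ≤ N) (r : ℕ) :
    ∃ K : ℕ, ∀ u ∈ L₁, ∀ v ∈ L₂, wordDist π (wordVal σ u) (wordVal π v) ≤ r →
      ∃ s t : ℕ → ℕ, Monotone s ∧ Function.Surjective s ∧ Monotone t ∧ Function.Surjective t ∧
        ∀ n, wordDist π (wordVal σ (u.take (s n))) (wordVal π (v.take (t n))) ≤ K := by
  obtain ⟨M, hM⟩ := exists_wordDist_map_le (MonoidHom.id G) σ hL₂.surjective
  obtain ⟨K₀, hK₀⟩ := hL₂.exists_near_of_near hN r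
  obtain ⟨K₂, hK₂⟩ := IsAutomatic.exists_near_of_near_of_prefix hL₁ hL₂ hN (K₀ + r)
  choose C hC using hL₂.exists_no_return
  refine ⟨2 * (K₀ + r) + K₂ + C (K₀ + r + K₂) +
    C (2 * (2 * (K₀ + r) + K₂ + C (K₀ + r + K₂)) + M * 1), fun u hu v hv huv => ?_⟩
  choose j hj using hK₀ u hu v hv huv
  -- The two paths are matched at their starts and at their ends; past the end of `u`, the term
  -- `v.length + i` keeps `J` unbounded while the prefix of `v` stays all of `v`.
  let J : ℕ → ℕ := fun i => if i = 0 then 0 else if i < u.length then j i else v.length + i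
  refine exists_monotone_near (p := fun i => wordVal σ (u.take i))
    (q := fun i => wordVal π (v.take i)) (J := J) (K₁ := K₀ + r) (K₂ := K₂) (M := M * 1) (C := C)
    rfl (fun n => ⟨n + u.length + 1, ?_⟩) (fun i => ?_) (fun i l hil i' hi' => ?_)
    (fun r' a b hab l => hC r' v hv a b hab l) (fun i => hM 1 _ _ (wordDist_take_succ σ u i))
  · simp only [J]
    rw [if_neg (by omega), if_neg (by omega)]
    omega
  · dsimp only [J]
    split_ifs with h₁ h₂
    · subst h₁
      rw [List.take_zero, List.take_zero, wordVal_nil, wordVal_nil, wordDist_self]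
      exact zero_le
    · exact wordDist_mono (hj i) (Nat.le_add_right _ _)
    · rw [List.take_of_length_le (not_lt.mp h₂), List.take_of_length_le (Nat.le_add_right _ _)]
      exact wordDist_mono huv (Nat.le_add_left _ _)
  · obtain ⟨l', hl'⟩ := hK₂ (u.take i) (u.drop i) (by rwa [List.take_append_drop])
      (v.take l) (v.drop l) (by rwa [List.take_append_drop]) hil i'
    rw [List.take_take, List.take_take, min_eq_left hi'] at hl'
    exact ⟨_, min_le_right _ _, hl'⟩

end Paths

section Paths

variable {G : Type*} [Group G] {A : Type*}

theorem path_mem_pathImage (π : FreeMonoid A →* G) (x : G) (w : List A) (n : ℕ) :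
    path π x w n ∈ pathImage π x w := by
  refine ⟨min n w.length, min_le_right _ _, ?_⟩
  rw [path, path]
  rcases le_total n w.length with h | h
  · rw [min_eq_left h]
  · rw [min_eq_right h, List.take_length, List.take_of_length_le h]

theorem FellowTravel.async {π : FreeMonoid A →* G} {K : ℕ} {u v : List A}
    (h : FellowTravel π K u v) : AsyncFellowTravel π K u v :=
  ⟨id, id, monotone_id, Function.surjective_id, monotone_id, Function.surjective_id, h⟩

theorem AsyncFellowTravel.symm {π : FreeMonoid A →* G} {K : ℕ} {u v : List A}
    (h : AsyncFellowTravel π K u v) : AsyncFellowTravel π K v u := by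
  obtain ⟨s, t, hs, hs', ht, ht', h⟩ := h
  exact ⟨t, s, ht, ht', hs, hs', fun n => by rw [wordDist_comm]; exact h n⟩

theorem AsyncFellowTravel.mono {π : FreeMonoid A →* G} {K M : ℕ} {u v : List A}
    (h : AsyncFellowTravel π K u v) (hKM : K ≤ M) : AsyncFellowTravel π M u v := by
  obtain ⟨s, t, hs, hs', ht, ht', h⟩ := h
  exact ⟨s, t, hs, hs', ht, ht', fun n => wordDist_mono (h n) hKM⟩

end Paths

/-! ### Fellow travelling in the union of `L₁` and `L₂''(H)`. -/

section Union

variable {G : Type*} [Group G] {A B : Type*} [Finite A] [Finite B] {H : Subgroup G}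
  {π : FreeMonoid B →* G} {ρ : FreeMonoid A →* H} {L₁ : Language A} {L₂ : Language B} {k : ℕ}

/-- Enlarging the alphabet changes the word metric only by Lipschitz factors in both directions. -/
theorem exists_fellowTravel_inl {C : Type*} [Finite C] {τ : FreeMonoid C →* H}
    (hL₁ : IsAutomatic ρ L₁) (r : ℕ) :
    ∃ K : ℕ, ∀ u ∈ L₁, ∀ v ∈ L₁, wordDist (unionHom ρ τ) (wordVal ρ u) (wordVal ρ v) ≤ r →
      FellowTravel (unionHom ρ τ) K (u.map Sum.inl) (v.map Sum.inl) := by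
  obtain ⟨M, hM⟩ := exists_wordDist_map_le (MonoidHom.id H) (unionHom ρ τ) hL₁.surjective
  obtain ⟨M', hM'⟩ := exists_wordDist_map_le (MonoidHom.id H) ρ
    (surjective_unionHom (π₂ := τ) hL₁.surjective)
  obtain ⟨K, hK⟩ := hL₁.exists_fellowTravel (M * r)
  refine ⟨M' * K, fun u hu v hv huv n => ?_⟩
  rw [← List.map_take, ← List.map_take, wordVal_unionHom_inl, wordVal_unionHom_inl]
  exact hM' _ _ _ (hK u hu v hv (hM _ _ _ huv) n)

/-- Push the end points into the ambient group, compare there the words of `L₂` that are shadowed,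
and return to `H` by properness of the inclusion. -/
theorem exists_fellowTravel_inr (hρ : Function.Surjective ρ) (hL₂ : IsAutomatic π L₂) (r : ℕ) :
    ∃ K : ℕ, ∀ c ∈ stdLang π L₂ H k, ∀ d ∈ stdLang π L₂ H k,
      wordDist (unionHom ρ (stdHom π L₂ H k)) (wordVal (stdHom π L₂ H k) c)
        (wordVal (stdHom π L₂ H k) d) ≤ r →
      FellowTravel (unionHom ρ (stdHom π L₂ H k)) K (c.map Sum.inr) (d.map Sum.inr) := by
  have := (finite_stdGens π L₂ H k).to_subtype
  obtain ⟨M, hM⟩ := exists_wordDist_map_le H.subtype (unionHom ρ (stdHom π L₂ H k)) hL₂.surjective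
  obtain ⟨K, hK⟩ := hL₂.exists_fellowTravel (M * r)
  obtain ⟨M', hM'⟩ := exists_wordDist_le_of_map_le H.subtype_injective
    (surjective_unionHom (π₂ := stdHom π L₂ H k) hρ) π (k + K + k)
  refine ⟨M', fun c hc d hd hcd n => ?_⟩
  obtain ⟨v, hv, hcv⟩ := exists_isShadow_of_mem_stdLang hc
  obtain ⟨w, hw, hdw⟩ := exists_isShadow_of_mem_stdLang hd
  have h₁ := hM _ _ _ hcd
  rw [Subgroup.subtype_apply, Subgroup.subtype_apply, hcv.val_eq, hdw.val_eq] at h₁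
  rw [← List.map_take, ← List.map_take, wordVal_unionHom_inr, wordVal_unionHom_inr]
  have h₂ := hdw.near n
  rw [wordDist_comm] at h₂
  exact hM' _ _ (wordDist_triangle (wordDist_triangle (hcv.near n) (hK v hv w hw h₁ n)) h₂)

/-- To establish a weak form of the fellow traveller property for the union of an automatic
structure and the standard language, it suffices to compare words of one with words of the other. -/
theorem exists_union_of_mixed (hL₁ : IsAutomatic ρ L₁) (hL₂ : IsAutomatic π L₂)
    {P : ℕ → List (A ⊕ stdGens π L₂ H k) → List (A ⊕ stdGens π L₂ H k) → Prop}
    (hmono : ∀ {K M u v}, P K u v → K ≤ M → P M u v) (hsymm : ∀ {K u v}, P K u v → P K v u)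
    (hP : ∀ {K u v}, FellowTravel (unionHom ρ (stdHom π L₂ H k)) K u v → P K u v)
    (hmixed : ∃ K, ∀ u ∈ L₁, ∀ c ∈ stdLang π L₂ H k,
      wordDist (unionHom ρ (stdHom π L₂ H k)) (wordVal ρ u) (wordVal (stdHom π L₂ H k) c) ≤ 1 →
      P K (u.map Sum.inl) (c.map Sum.inr)) :
    ∃ K, ∀ u ∈ unionLang L₁ (stdLang π L₂ H k), ∀ v ∈ unionLang L₁ (stdLang π L₂ H k),
      wordDist (unionHom ρ (stdHom π L₂ H k)) (wordVal (unionHom ρ (stdHom π L₂ H k)) u)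
        (wordVal (unionHom ρ (stdHom π L₂ H k)) v) ≤ 1 → P K u v := by
  have := (finite_stdGens π L₂ H k).to_subtype
  obtain ⟨K₁, h₁⟩ := exists_fellowTravel_inl (τ := stdHom π L₂ H k) hL₁ 1
  obtain ⟨K₂, h₂⟩ := exists_fellowTravel_inr (k := k) hL₁.surjective hL₂ 1
  obtain ⟨K₃, h₃⟩ := hmixed
  refine ⟨K₁ + K₂ + K₃, ?_⟩
  rintro _ (⟨u, hu, rfl⟩ | ⟨c, hc, rfl⟩) _ (⟨v, hv, rfl⟩ | ⟨d, hd, rfl⟩) h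
  · rw [wordVal_unionHom_inl, wordVal_unionHom_inl] at h
    exact hmono (hP (h₁ u hu v hv h)) (by omega)
  · rw [wordVal_unionHom_inl, wordVal_unionHom_inr] at h
    exact hmono (h₃ u hu d hd h) (by omega)
  · rw [wordVal_unionHom_inl, wordVal_unionHom_inr, wordDist_comm] at h
    exact hmono (hsymm (h₃ v hv c hc h)) (by omega)
  · rw [wordVal_unionHom_inr, wordVal_unionHom_inr] at h
    exact hmono (hP (h₂ c hc d hd h)) (by omega)

/-- Each `c` is replaced by the word `v` it shadows, `u` and `v` are matched in the ambient group,
and the bound `K + k` is brought back to `H` by properness. -/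
theorem isAsyncAutomatic_union (hL₁ : IsAutomatic ρ L₁) (hL₂ : IsAutomatic π L₂) {N : ℕ}
    (hN : ∀ u ∈ L₁, ∀ v ∈ L₂, wordVal π v = wordVal ρ u →
      ∀ i, ∃ j, wordDist π (wordVal ρ (u.take i) : H) (wordVal π (v.take j)) ≤ N) :
    Equivalent ρ L₁ (stdHom π L₂ H k) (stdLang π L₂ H k) := by
  have := (finite_stdGens π L₂ H k).to_subtype
  refine ⟨isRationalSection_union hL₁.toIsRationalSection (isRegular_stdLang hL₂.regular),
    exists_union_of_mixed hL₁ hL₂ AsyncFellowTravel.mono AsyncFellowTravel.symm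
      FellowTravel.async ?_⟩
  obtain ⟨M, hM⟩ := exists_wordDist_map_le H.subtype (unionHom ρ (stdHom π L₂ H k)) hL₂.surjective
  obtain ⟨K, hK⟩ :=
    IsAutomatic.exists_async (σ := H.subtype.comp ρ) hL₁.regular hL₂ hN (M * 1)
  obtain ⟨M', hM'⟩ := exists_wordDist_le_of_map_le H.subtype_injective
    (surjective_unionHom (π₂ := stdHom π L₂ H k) hL₁.surjective) π (K + k)
  refine ⟨M', fun u hu c hc huc => ?_⟩
  obtain ⟨v, hv, hcv⟩ := exists_isShadow_of_mem_stdLang hc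
  have h₁ := hM 1 _ _ huc
  rw [Subgroup.subtype_apply, Subgroup.subtype_apply, hcv.val_eq] at h₁
  obtain ⟨s, t, hs, hs', ht, ht', h⟩ := hK u hu v hv h₁
  refine ⟨s, t, hs, hs', ht, ht', fun n => ?_⟩
  rw [← List.map_take, ← List.map_take, wordVal_unionHom_inl, wordVal_unionHom_inr]
  have h₂ := hcv.near (t n)
  rw [wordDist_comm] at h₂
  exact hM' _ _ (wordDist_triangle (h n) h₂)

/-- The chain is `u`, a word `w` of `L₂` with the same value, the word `v` shadowed by `c`, then
`c`; its links cost `N`, `K` and `k`. -/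
theorem isAutomatic_union (hL₁ : IsAutomatic ρ L₁) (hL₂ : IsAutomatic π L₂) {N : ℕ}
    (hN : ∀ u ∈ L₁, ∀ v ∈ L₂, wordVal π v = wordVal ρ u →
      ∀ i, wordDist π (wordVal ρ (u.take i) : H) (wordVal π (v.take i)) ≤ N) :
    SyncEquivalent ρ L₁ (stdHom π L₂ H k) (stdLang π L₂ H k) := by
  have := (finite_stdGens π L₂ H k).to_subtype
  obtain ⟨M, hM⟩ := exists_wordDist_map_le H.subtype (unionHom ρ (stdHom π L₂ H k)) hL₂.surjective
  obtain ⟨K, hK⟩ := hL₂.exists_fellowTravel (M * 1)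
  obtain ⟨M', hM'⟩ := exists_wordDist_le_of_map_le H.subtype_injective
    (surjective_unionHom (π₂ := stdHom π L₂ H k) hL₁.surjective) π (N + K + k)
  suffices hmixed : ∀ u ∈ L₁, ∀ c ∈ stdLang π L₂ H k,
      wordDist (unionHom ρ (stdHom π L₂ H k)) (wordVal ρ u) (wordVal (stdHom π L₂ H k) c) ≤ 1 →
      FellowTravel (unionHom ρ (stdHom π L₂ H k)) M' (u.map Sum.inl) (c.map Sum.inr) by
    obtain ⟨p, hp⟩ := exists_union_of_mixed (P := FellowTravel (unionHom ρ (stdHom π L₂ H k)))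
      hL₁ hL₂ FellowTravel.mono FellowTravel.symm (fun h => h) ⟨M', hmixed⟩
    exact (isRationalSection_union hL₁.toIsRationalSection
      (isRegular_stdLang hL₂.regular)).isAutomatic hp
  intro u hu c hc huc n
  obtain ⟨v, hv, hcv⟩ := exists_isShadow_of_mem_stdLang hc
  obtain ⟨w, hw, hval⟩ := hL₂.onto (wordVal ρ u : H)
  have h₁ := hM 1 _ _ huc
  rw [Subgroup.subtype_apply, Subgroup.subtype_apply, hcv.val_eq, ← hval] at h₁
  rw [← List.map_take, ← List.map_take, wordVal_unionHom_inl, wordVal_unionHom_inr]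
  have h₂ := hcv.near n
  rw [wordDist_comm] at h₂
  exact hM' _ _ (wordDist_triangle (wordDist_triangle (hN u hu w hw hval n)
    (hK w hw v hv h₁ n)) h₂)

end Union

/-! ### The bounded reduction property against equivalence. -/

section BoundedReduction

variable {G₁ G₂ : Type*} [Group G₁] [Group G₂] {A B : Type*} {π₁ : FreeMonoid A →* G₁}
  {L₁ : Language A} {π₂ : FreeMonoid B →* G₂} {L₂ : Language B} {φ : G₁ →* G₂} {k : ℕ}

theorem map_path (φ : G₁ →* G₂) (π₁ : FreeMonoid A →* G₁) (x : G₁) (u : List A) (n : ℕ) :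
    φ (path π₁ x u n) = φ x * wordVal (φ.rangeRestrict.comp π₁) (u.take n) := map_mul _ _ _

theorem BRP.exists_near (h : BRP φ π₁ L₁ π₂ L₂) :
    ∃ N : ℕ, ∀ u ∈ L₁, ∀ v ∈ L₂, wordVal π₂ v = wordVal (φ.rangeRestrict.comp π₁) u → ∀ i, ∃ j,
      wordDist π₂ (wordVal (φ.rangeRestrict.comp π₁) (u.take i) : φ.range)
        (wordVal π₂ (v.take j)) ≤ N := by
  obtain ⟨N, -, hN⟩ := h
  refine ⟨N + 1, fun u hu v hv huv i => ?_⟩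
  obtain ⟨_, ⟨j, -, rfl⟩, hj⟩ := exists_mem_of_haus_le (hN 1 u hu v hv huv)
    ⟨_, path_mem_pathImage π₁ 1 u i, rfl⟩
  refine ⟨j, ?_⟩
  rwa [map_path, path, map_one, one_mul, one_mul] at hj

theorem SyncBRP.exists_near (h : SyncBRP φ π₁ L₁ π₂ L₂) :
    ∃ N : ℕ, ∀ u ∈ L₁, ∀ v ∈ L₂, wordVal π₂ v = wordVal (φ.rangeRestrict.comp π₁) u → ∀ i,
      wordDist π₂ (wordVal (φ.rangeRestrict.comp π₁) (u.take i) : φ.range)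
        (wordVal π₂ (v.take i)) ≤ N := by
  obtain ⟨N, -, hN⟩ := h
  refine ⟨N, fun u hu v hv huv i => ?_⟩
  have := hN i 1 u hu v hv huv
  rwa [map_path, path, map_one, one_mul, one_mul] at this

theorem IsQuasiconvexWith.exists_isShadow_of_val_eq (hk : IsQuasiconvexWith π₂ L₂ φ.range k)
    {u : List A} {v : List B} (hv : v ∈ L₂) (huv : wordVal π₂ v = φ (wordVal π₁ u)) :
    ∃ c ∈ stdLang π₂ L₂ φ.range k, IsShadow c v ∧
      wordVal (φ.rangeRestrict.comp π₁) u = wordVal (stdHom π₂ L₂ φ.range k) c := by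
  obtain ⟨c, hc, hcv⟩ := hk.exists_isShadow ⟨hv, huv ▸ ⟨_, rfl⟩⟩
  exact ⟨c, hc, hcv, Subtype.ext ((hcv.val_eq.trans huv).symm)⟩

theorem brp_of_equivalent [Finite A] [Finite B] (hπ₂ : Function.Surjective π₂)
    (hk : IsQuasiconvexWith π₂ L₂ φ.range k)
    (h : Equivalent (φ.rangeRestrict.comp π₁) L₁ (stdHom π₂ L₂ φ.range k)
      (stdLang π₂ L₂ φ.range k)) : BRP φ π₁ L₁ π₂ L₂ := by
  have := (finite_stdGens π₂ L₂ φ.range k).to_subtype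
  obtain ⟨p, hp⟩ := h.fellowTravel
  obtain ⟨M, hM⟩ := exists_wordDist_map_le φ.range.subtype
    (unionHom (φ.rangeRestrict.comp π₁) (stdHom π₂ L₂ φ.range k)) hπ₂
  -- `M * p` carries the fellow traveller bound to `d_B`, `k` passes from the shadow to `v`, and `1`
  -- ensures positivity.
  refine ⟨M * p + k + 1, Nat.succ_pos _, fun x u hu v hv huv => ?_⟩
  obtain ⟨c, hc, hcv, hval⟩ := hk.exists_isShadow_of_val_eq hv huv
  obtain ⟨s, t, -, hs, -, ht, hst⟩ := hp (u.map Sum.inl) (Or.inl ⟨u, hu, rfl⟩) (c.map Sum.inr)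
    (Or.inr ⟨c, hc, rfl⟩)
    (by rw [wordVal_unionHom_inl, wordVal_unionHom_inr, hval, wordDist_self]; exact zero_le)
  have hnear : ∀ n, wordDist π₂ (φ (path π₁ x u (s n))) (path π₂ (φ x) v (t n)) ≤
      (M * p + k + 1 : ℕ) := by
    intro n
    have h₁ := hst n
    rw [← List.map_take, ← List.map_take, wordVal_unionHom_inl, wordVal_unionHom_inr] at h₁
    rw [map_path]
    exact wordDist_mono (wordDist_mul_left_le (φ x)
      (wordDist_triangle (hM _ _ _ h₁) (hcv.near (t n)))) (Nat.le_succ _)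
  -- Surjectivity of `s` and of `t` gives one inclusion each, since every vertex of either path gets
  -- matched.
  refine sInf_le ⟨by positivity, ?_, ?_⟩
  · rintro _ ⟨_, ⟨n, -, rfl⟩, rfl⟩
    obtain ⟨m, rfl⟩ := hs n
    exact setDist_le_of_mem (path_mem_pathImage _ _ _ _) (hnear m)
  · rintro _ ⟨n, -, rfl⟩
    obtain ⟨m, rfl⟩ := ht n
    refine setDist_le_of_mem ⟨_, path_mem_pathImage π₁ x u (s m), rfl⟩ ?_
    rw [wordDist_comm]
    exact hnear m

theorem syncBRP_of_syncEquivalent [Finite A] [Finite B] (hπ₂ : Function.Surjective π₂)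
    (hk : IsQuasiconvexWith π₂ L₂ φ.range k)
    (h : SyncEquivalent (φ.rangeRestrict.comp π₁) L₁ (stdHom π₂ L₂ φ.range k)
      (stdLang π₂ L₂ φ.range k)) : SyncBRP φ π₁ L₁ π₂ L₂ := by
  have := (finite_stdGens π₂ L₂ φ.range k).to_subtype
  -- Radius `0` suffices: `u` and the shadow of `v` have the same value.
  obtain ⟨p, hp⟩ := IsAutomatic.exists_fellowTravel h 0
  obtain ⟨M, hM⟩ := exists_wordDist_map_le φ.range.subtype
    (unionHom (φ.rangeRestrict.comp π₁) (stdHom π₂ L₂ φ.range k)) hπ₂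
  refine ⟨M * p + k + 1, Nat.succ_pos _, fun n x u hu v hv huv => ?_⟩
  obtain ⟨c, hc, hcv, hval⟩ := hk.exists_isShadow_of_val_eq hv huv
  have h₁ := hp (u.map Sum.inl) (Or.inl ⟨u, hu, rfl⟩) (c.map Sum.inr) (Or.inr ⟨c, hc, rfl⟩)
    (by rw [wordVal_unionHom_inl, wordVal_unionHom_inr, hval, wordDist_self]; exact zero_le) n
  rw [← List.map_take, ← List.map_take, wordVal_unionHom_inl, wordVal_unionHom_inr] at h₁
  rw [map_path]
  exact wordDist_mono (wordDist_mul_left_le (φ x)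
    (wordDist_triangle (hM _ _ _ h₁) (hcv.near n))) (Nat.le_succ _)

end BoundedReduction

end AutGroups

theorem theorem4p5 {G₁ G₂ : Type*} [Group G₁] [Group G₂] {A B : Type*} [Finite A] [Finite B]
    (π₁ : FreeMonoid A →* G₁) (L₁ : Language A) (hL₁ : AutGroups.IsAutomatic π₁ L₁)
    (π₂ : FreeMonoid B →* G₂) (L₂ : Language B) (hL₂ : AutGroups.IsAutomatic π₂ L₂)
    (φ : G₁ →* G₂) (k : ℕ) (hk : AutGroups.IsQuasiconvexWith π₂ L₂ φ.range k)
    (hφ : AutGroups.InducesAutomatic φ π₁ L₁) :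
    (AutGroups.Equivalent (φ.rangeRestrict.comp π₁) L₁
        (AutGroups.stdHom π₂ L₂ φ.range k) (AutGroups.stdLang π₂ L₂ φ.range k) ↔
      AutGroups.BRP φ π₁ L₁ π₂ L₂) ∧
    (AutGroups.SyncEquivalent (φ.rangeRestrict.comp π₁) L₁
        (AutGroups.stdHom π₂ L₂ φ.range k) (AutGroups.stdLang π₂ L₂ φ.range k) ↔
      AutGroups.SyncBRP φ π₁ L₁ π₂ L₂) := by
  refine ⟨⟨AutGroups.brp_of_equivalent hL₂.surjective hk, fun h => ?_⟩,
    ⟨AutGroups.syncBRP_of_syncEquivalent hL₂.surjective hk, fun h => ?_⟩⟩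
  · obtain ⟨N, hN⟩ := h.exists_near
    exact AutGroups.isAsyncAutomatic_union hφ hL₂ hN
  · obtain ⟨N, hN⟩ := h.exists_near
    exact AutGroups.isAutomatic_union hφ hL₂ hN
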